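/- **Theorem (spectral asymptotics, degenerate arithmetic case).** Let $a_1,\dots,a_n>0$ with $\sum_k a_k=1$, let $d_k,\beta_k\in\mathbb R$ with $\sum_k a_k d_k^2<1$, and put $\alpha_k=\sum_{i<k}a_i$. Let $P\in L_2[0,1]$ be the real function that is self-similar with these parameters, i.e. for every $k$ $$P(x)=d_k\,P\!\left(\frac{x-\alpha_k}{a_k}\right)+\beta_k\qquad\text{for almost every }x\in(\alpha_k,\alpha_k+a_k).$$ Suppose that the self-similarity is arithmetic with step $\nu>0$, i.e. the additive subgroup of $\mathbb R$ generated by the numbers $\ln(a_k|d_k|)$ with $d_k\ne0$ equals $\nu\mathbb Z$, and that its spectral order $D$, a solution of $\sum_{k:\,d_k\neq0}(a_k|d_k|)^{D/2}=1$, is positive. Let $\mathring W_2^1[0,1]$ be the complex space of absolutely continuous functions on $[0,1]$ with derivative in $L_2$ and vanishing at $0$ and $1$; let $\rho=P'$ be the generalized derivative, $\langle\rho,y\rangle=-\int_0^1P\,\overline{y'}\,dx$ for $y\in\mathring W_2^1[0,1]$. For $\lambda\in\mathbb R$ let $T_\rho(\lambda)$ be given by $$\langle T_\rho(\lambda)y,z\rangle=\int_0^1\left\{y'\overline{z'}+\lambda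 P\,(y'\overline z+y\,\overline{z'})\right\}dx,\qquad y,z\in\mathring W_2^1[0,1],$$ and let $\operatorname{ind}T_\rho(\lambda)$ be its negative index of inertia, the maximal dimension of a subspace of $\mathring W_2^1[0,1]$ on which $\langle T_\rho(\lambda)y,y\rangle<0$ for all $y\ne0$. Assume that 1. $\rho\ne0$; 2. for each $k$ with $d_k>0$ the ratio $\ln(a_k|d_k|)/\nu$ is an even integer; 3. for each $k$ with $d_k<0$ the ratio $\ln(a_k|d_k|)/\nu$ is an odd integer. Then $\operatorname{ind}T_\rho(\lambda)$ is finite for every $\lambda\in\mathbb R$, and there is a continuous positive $2$-periodic function $s:\mathbb R\to\mathbb R$ such that $$\operatorname{ind}T_\rho(\lambda)=\lambda^{D/2}\left(s\!\left(\frac{\ln\lambda}{\nu}\right)+o(1)\right)\quad(\lambda\to+\infty),$$ $$\operatorname{ind}T_\rho(\lambda)=|\lambda|^{D/2}\left(s\!\left(\frac{\ln|\lambda|}{\nu}-1\right)+o(1)\right)\quad(\lambda\to-\infty).$$ -/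

import Mathlib

open MeasureTheory Filter Topology

noncomputable section

namespace SelfSimilarSturm

/-- The left end point `α_k = ∑_{i<k} a_i` of the `k`-th interval of the partition of `[0,1]`
into consecutive intervals of lengths `a_1, …, a_n`. -/
def leftEnd {n : ℕ} (a : Fin n → ℝ) (k : Fin n) : ℝ := ∑ i ∈ Finset.univ.filter (· < k), a i

/-- The similarity operator: on the `k`-th interval `(α_k, α_k + a_k)` the function `G f` equals
`d_k f((x - α_k)/a_k) + β_k`. -/
def similarityOp {n : ℕ} (a d β : Fin n → ℝ) (f : ℝ → ℝ) : ℝ → ℝ := fun x =>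
  ∑ k, (Set.Ioo (leftEnd a k) (leftEnd a k + a k)).indicator
    (fun t => d k * f ((t - leftEnd a k) / a k) + β k) x

/-- `P ∈ L₂[0,1]` is self-similar with parameters `a, d, β`: the numbers `a_k` are the lengths of
a partition of `[0,1]`, the similarity operator is a contraction of `L₂[0,1]`
(that is `∑ a_k d_k² < 1`), and `P` is its fixed point. -/
structure IsSelfSimilar {n : ℕ} (a d β : Fin n → ℝ) (P : ℝ → ℝ) : Prop where
  pos : ∀ k, 0 < a k
  sum_eq_one : ∑ k, a k = 1
  contraction : ∑ k, a k * d k ^ 2 < 1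
  memLp : MemLp P 2 (volume.restrict (Set.Icc 0 1))
  fixed : P =ᵐ[volume.restrict (Set.Icc 0 1)] similarityOp a d β P

/-- `D` is a solution of `∑_{d_k ≠ 0} (a_k |d_k|)^{D/2} = 1`. -/
def IsSpectralOrder {n : ℕ} (a d : Fin n → ℝ) (D : ℝ) : Prop :=
  ∑ k ∈ Finset.univ.filter (fun k => d k ≠ 0), (a k * |d k|) ^ (D / 2) = 1

/-- The self-similarity is arithmetic with step `ν > 0`: the additive group generated by the
numbers `ln (a_k |d_k|)`, `d_k ≠ 0`, is `ν ℤ`. -/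
def IsArithmeticWithStep {n : ℕ} (a d : Fin n → ℝ) (ν : ℝ) : Prop :=
  0 < ν ∧
    AddSubgroup.closure {x : ℝ | ∃ k, d k ≠ 0 ∧ x = Real.log (a k * |d k|)} =
      AddSubgroup.zmultiples ν

/-- The complex Sobolev space of absolutely continuous functions on `[0,1]` with square integrable
derivative that vanish at `0` and `1` (the functions being extended by zero to the line). The
derivative of such a function `y` is `deriv y`, which exists almost everywhere. -/
def sobolevZero : Submodule ℂ (ℝ → ℂ) where
  carrier := {y | (∀ x, x ∉ Set.Ioo (0 : ℝ) 1 → y x = 0) ∧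
    ∃ g : ℝ → ℂ, MemLp g 2 (volume.restrict (Set.Icc 0 1)) ∧
      ∀ x ∈ Set.Icc (0 : ℝ) 1, y x = ∫ t in (0 : ℝ)..x, g t}
  zero_mem' := ⟨fun _ _ => rfl, 0, MemLp.zero, fun x _ => by simp⟩
  add_mem' := by
    rintro y z ⟨hy, g, hg, hyg⟩ ⟨hz, h, hh, hzh⟩
    have key : ∀ f : ℝ → ℂ, MemLp f 2 (volume.restrict (Set.Icc (0 : ℝ) 1)) →
        ∀ x ∈ Set.Icc (0 : ℝ) 1, IntervalIntegrable f volume 0 x := by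
      intro f hf x hx
      have h1 : IntegrableOn f (Set.Icc (0 : ℝ) 1) volume := hf.integrable (by norm_num)
      rw [intervalIntegrable_iff_integrableOn_Ioc_of_le hx.1]
      exact h1.mono_set fun t ht => ⟨ht.1.le, ht.2.trans hx.2⟩
    refine ⟨fun x hx => by simp [hy x hx, hz x hx], g + h, hg.add hh, fun x hx => ?_⟩
    simp only [Pi.add_apply]
    rw [intervalIntegral.integral_add (key g hg x hx) (key h hh x hx), hyg x hx, hzh x hx]
  smul_mem' := by
    rintro c y ⟨hy, g, hg, hyg⟩
    refine ⟨fun x hx => by simp [hy x hx], c • g, hg.const_smul c, fun x hx => ?_⟩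
    simp only [Pi.smul_apply]
    rw [intervalIntegral.integral_smul, hyg x hx]

/-- The generalized derivative `ρ = P'` as an antilinear functional on the Sobolev space:
`⟨ρ, y⟩ = -∫₀¹ P · conj y'`. -/
def genDeriv (P : ℝ → ℝ) (y : sobolevZero) : ℂ :=
  -∫ x in (0 : ℝ)..1, (P x : ℂ) * star (deriv (y : ℝ → ℂ) x)

/-- The pencil `T_ρ(λ)`, given by
`⟨T_ρ(λ) y, z⟩ = ∫₀¹ (y' conj z' + λ P (y' conj z + y conj z'))`. -/
def pencil (P : ℝ → ℝ) (l : ℝ) (y z : sobolevZero) : ℂ :=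
  ∫ x in (0 : ℝ)..1,
    (deriv (y : ℝ → ℂ) x * star (deriv (z : ℝ → ℂ) x) +
      (l : ℂ) * (P x : ℂ) * (deriv (y : ℝ → ℂ) x * star ((z : ℝ → ℂ) x) +
        (y : ℝ → ℂ) x * star (deriv (z : ℝ → ℂ) x)))

/-- The negative index of inertia `ind T_ρ(λ)`: the supremum of the dimensions of the subspaces
of the Sobolev space on which the (Hermitian) form of `T_ρ(λ)` is negative definite. -/
def negIndex (P : ℝ → ℝ) (l : ℝ) : ℕ∞ :=
  ⨆ (V : Submodule ℂ sobolevZero) (_ : ∀ y ∈ V, y ≠ 0 → (pencil P l y y).re < 0),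
    Cardinal.toENat (Module.rank ℂ V)

end SelfSimilarSturm

end

/-!
The index `N(l) = ind T_ρ(l)` satisfies a renewal equation. An element of the Sobolev space that
vanishes at the points of the partition splits into `n` pieces, and after an affine change of
variable on the `k`-th interval the quadratic form of `T_ρ(l)` becomes `a_k⁻¹` times the form of
`T_ρ(a_k d_k l)`; the constant `β_k` drops out because `∫ (|u|²)' = 0`. The vanishing conditions
have codimension at most `n`, hence `∑ N(a_k d_k l) ≤ N(l) ≤ ∑ N(a_k d_k l) + n`
(`IsSelfSimilar.le_negIndex`, `IsSelfSimilar.negIndex_le`). Since `N` vanishes near zero and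
`a_k |d_k| < 1`, the index is finite.

The parity conditions say that `a_k d_k = (-1)^{m_k} e^{-ν m_k}` with integers `m_k ≥ 1`, so along a
progression `l_i = (-1)^i e^{ν (t + i)}` the recursion reads `x_i = ∑ x_{i - m_k} + O(1)`. After
division by `e^{ν D (t + i) / 2}` its weights are `(a_k |d_k|)^{D/2}`, with sum one, and its error
is geometrically small. As the step is exactly `ν`, the `m_k` have greatest common divisor one, and
the discrete renewal theorem (`renewal_uniform`) gives a limit `s(t)`, uniformly for bounded `t`.
The limit is positive because `ρ ≠ 0` makes the index positive for all large `l` of one sign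
(`one_le_negIndex_of_large`). Moving `t` by two shifts the progression onto itself, which gives the
period, and the odd terms of the progression carry the asymptotics at `-∞`.

The limit `s` is continuous because the jumps of `N` are bounded (`eventually_negIndex`): a vector
of the kernel of `T_ρ(l)` has constant quasi-derivative `y' + l P y - l ∫ P y'`, and since
`y(0) = 0` it is determined by this constant. The quantitative form of this fact, the estimate
`exists_norm_derivMap_le` coming from Gronwall's inequality, makes the form coercive on a subspace
of codimension `N(l) + 1` without any compactness argument (`eventually_negInd_le`).
-/

namespace SelfSimilarSturm

/-! ### The negative index of inertia of a Hermitian form -/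

section NegInd

variable {E F : Type*} [AddCommGroup E] [Module ℂ E] [AddCommGroup F] [Module ℂ F]

/-- The negative index of inertia of a sesquilinear form: the supremum of the dimensions of the
subspaces on which the form is negative definite. -/
noncomputable def negInd (B : E →ₗ[ℂ] E →ₗ⋆[ℂ] ℂ) : ℕ∞ :=
  ⨆ (V : Submodule ℂ E) (_ : ∀ y ∈ V, y ≠ 0 → (B y y).re < 0), Cardinal.toENat (Module.rank ℂ V)

/-- A form is Hermitian if exchanging its arguments conjugates its value. -/
def IsHermForm (B : E →ₗ[ℂ] E →ₗ⋆[ℂ] ℂ) : Prop := ∀ y z, B z y = star (B y z)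

/-- A finite family that is orthonormal for `-B`. -/
def IsNegOrthonormal {m : ℕ} (B : E →ₗ[ℂ] E →ₗ⋆[ℂ] ℂ) (v : Fin m → E) : Prop :=
  ∀ i j, B (v i) (v j) = if i = j then -1 else 0

lemma finrank_le_negInd [FiniteDimensional ℂ F] (B : E →ₗ[ℂ] E →ₗ⋆[ℂ] ℂ) (f : F →ₗ[ℂ] E)
    (hf : ∀ x, x ≠ 0 → (B (f x) (f x)).re < 0) : (Module.finrank ℂ F : ℕ∞) ≤ negInd B := by
  have hinj : Function.Injective f := by
    rw [← LinearMap.ker_eq_bot, LinearMap.ker_eq_bot']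
    intro x hx
    by_contra h
    have := hf x h
    simp [hx] at this
  have h1 : Cardinal.toENat (Module.rank ℂ (LinearMap.range f)) = (Module.finrank ℂ F : ℕ∞) := by
    rw [← Module.finrank_eq_rank, LinearMap.finrank_range_of_inj hinj]
    simp
  rw [← h1]
  refine le_iSup₂_of_le (LinearMap.range f) ?_ le_rfl
  rintro y ⟨x, rfl⟩ hy
  exact hf x (fun h => hy (by simp [h]))

/-- If the form is nonnegative on the kernel of a linear map to a space of dimension `m`, then its
negative index is at most `m`. -/
lemma negInd_le_finrank [FiniteDimensional ℂ F] (B : E →ₗ[ℂ] E →ₗ⋆[ℂ] ℂ) (φ : E →ₗ[ℂ] F)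
    (hφ : ∀ y, φ y = 0 → 0 ≤ (B y y).re) : negInd B ≤ Module.finrank ℂ F := by
  refine iSup₂_le fun V hV => ?_
  have hinj : Function.Injective (φ ∘ₗ V.subtype) := by
    rw [← LinearMap.ker_eq_bot, LinearMap.ker_eq_bot']
    rintro ⟨x, hx⟩ h0
    by_contra h
    have h1 := hV x hx (fun h' => h (by simp [h']))
    have h2 := hφ x (by simpa using h0)
    linarith
  have : FiniteDimensional ℂ V := FiniteDimensional.of_injective _ hinj
  have h3 := LinearMap.finrank_le_finrank_of_injective hinj
  rw [← Module.finrank_eq_rank, Cardinal.toENat_nat]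
  exact_mod_cast h3

lemma IsNegOrthonormal.apply_sum_left {m : ℕ} {B : E →ₗ[ℂ] E →ₗ⋆[ℂ] ℂ} {v : Fin m → E}
    (hv : IsNegOrthonormal B v) (c : Fin m → ℂ) (j : Fin m) :
    B (∑ i, c i • v i) (v j) = -c j := by
  simp [map_sum, LinearMap.sum_apply, hv _ j]

lemma IsNegOrthonormal.apply_sum_sum {m : ℕ} {B : E →ₗ[ℂ] E →ₗ⋆[ℂ] ℂ} {v : Fin m → E}
    (hv : IsNegOrthonormal B v) (c : Fin m → ℂ) :
    (B (∑ i, c i • v i) (∑ i, c i • v i)).re = -∑ i, ‖c i‖ ^ 2 := by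
  rw [map_sum]
  simp_rw [LinearMap.map_smulₛₗ, hv.apply_sum_left]
  rw [Complex.re_sum, ← Finset.sum_neg_distrib]
  refine Finset.sum_congr rfl fun i _ => ?_
  rw [smul_eq_mul, mul_neg, Complex.neg_re, Complex.conj_mul']
  norm_cast

/-- Appending a vector on which the form equals `-1` and which is orthogonal to the family. -/
lemma IsNegOrthonormal.snoc {m : ℕ} {B : E →ₗ[ℂ] E →ₗ⋆[ℂ] ℂ} (hB : IsHermForm B) {v : Fin m → E}
    (hv : IsNegOrthonormal B v) {y : E} (hy : ∀ i, B y (v i) = 0) (hneg : (B y y).re < 0) :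
    ∃ c : ℂ, IsNegOrthonormal B (Fin.snoc v (c • y) : Fin (m + 1) → E) := by
  have him : B y y = ((B y y).re : ℂ) := by
    have := hB y y
    exact (Complex.conj_eq_iff_real.1 this.symm).elim fun r hr => by rw [hr]; simp
  set t := -(B y y).re with ht
  have htpos : 0 < t := by linarith
  refine ⟨(((Real.sqrt t)⁻¹ : ℝ) : ℂ), ?_⟩
  have hy' : ∀ i, B (v i) y = 0 := fun i => by rw [hB y (v i), hy i, star_zero]
  intro i j
  induction i using Fin.lastCases with
  | last =>
    induction j using Fin.lastCases with
    | last =>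
      simp only [Fin.snoc_last, LinearMap.map_smulₛₗ, LinearMap.smul_apply, if_true, smul_eq_mul]
      rw [him, show (B y y).re = -t by simp [ht]]
      simp only [Complex.conj_ofReal, RingHom.id_apply]
      norm_cast
      have := Real.mul_self_sqrt htpos.le
      have h0 : Real.sqrt t ≠ 0 := (Real.sqrt_pos.2 htpos).ne'
      field_simp
      simp [sq, this]
    | cast j =>
      simp [hy, (Fin.castSucc_lt_last j).ne']
  | cast i =>
    induction j using Fin.lastCases with
    | last => simp [hy', (Fin.castSucc_lt_last i).ne]
    | cast j => simp [hv i j]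

lemma exists_isNegOrthonormal {B : E →ₗ[ℂ] E →ₗ⋆[ℂ] ℂ} (hB : IsHermForm B) {m : ℕ}
    (hm : (m : ℕ∞) ≤ negInd B) : ∃ v : Fin m → E, IsNegOrthonormal B v := by
  rcases Nat.eq_zero_or_pos m with rfl | hpos
  · exact ⟨Fin.elim0, fun i => i.elim0⟩
  obtain ⟨V, hV, hrank⟩ : ∃ V : Submodule ℂ E, (∀ y ∈ V, y ≠ 0 → (B y y).re < 0) ∧
      (m : ℕ∞) ≤ Cardinal.toENat (Module.rank ℂ V) := by
    by_contra! h
    have h1 : negInd B ≤ ((m - 1 : ℕ) : ℕ∞) := by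
      refine iSup₂_le fun V hV => ?_
      have h2 := h V hV
      have h3 : Cardinal.toENat (Module.rank ℂ V) ≠ ⊤ := (h2.trans_le le_top).ne
      obtain ⟨r, hr⟩ := ENat.ne_top_iff_exists.1 h3
      rw [← hr] at h2 ⊢
      rw [Nat.cast_lt] at h2
      rw [Nat.cast_le]
      omega
    have h3 := hm.trans h1
    rw [Nat.cast_le] at h3
    omega
  have key : ∀ k ≤ m, ∃ v : Fin k → E, (∀ i, v i ∈ V) ∧ IsNegOrthonormal B v := by
    intro k
    induction k with
    | zero => exact fun _ => ⟨Fin.elim0, fun i => i.elim0, fun i => i.elim0⟩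
    | succ k ih =>
      intro hk
      obtain ⟨v, hvV, hv⟩ := ih (by omega)
      -- the dimension of `V` exceeds `k`, so some vector of `V` is orthogonal to the family
      let ψ : V →ₗ[ℂ] (Fin k → ℂ) := LinearMap.pi fun i => B.flip (v i) ∘ₗ V.subtype
      have hψ : ¬ Function.Injective ψ := by
        intro hinj
        have : FiniteDimensional ℂ V := FiniteDimensional.of_injective _ hinj
        have h1 := LinearMap.finrank_le_finrank_of_injective hinj
        rw [← Module.finrank_eq_rank, Cardinal.toENat_nat, Nat.cast_le] at hrank
        rw [Module.finrank_fin_fun] at h1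
        omega
      rw [← LinearMap.ker_eq_bot, LinearMap.ker_eq_bot'] at hψ
      push Not at hψ
      obtain ⟨⟨y, hyV⟩, hy0, hyne⟩ := hψ
      obtain ⟨c, hc⟩ := hv.snoc hB (y := y) (fun i => congrFun hy0 i)
        (hV y hyV (fun h => hyne (by simp [h])))
      refine ⟨_, fun i => ?_, hc⟩
      induction i using Fin.lastCases with
      | last => simpa using V.smul_mem c hyV
      | cast i => simpa using hvV i
  obtain ⟨v, -, hv⟩ := key m le_rfl
  exact ⟨v, hv⟩

lemma IsNegOrthonormal.le_negInd {B : E →ₗ[ℂ] E →ₗ⋆[ℂ] ℂ} {m : ℕ} {v : Fin m → E}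
    (hv : IsNegOrthonormal B v) : (m : ℕ∞) ≤ negInd B := by
  have := finrank_le_negInd B (Fintype.linearCombination ℂ v) (fun c hc => by
    rw [Fintype.linearCombination_apply, hv.apply_sum_sum]
    obtain ⟨i, hi⟩ := Function.ne_iff.1 hc
    have : 0 < ∑ i, ‖c i‖ ^ 2 :=
      Finset.sum_pos' (fun _ _ => by positivity) ⟨i, Finset.mem_univ _, by
        have := norm_pos_iff.2 hi
        positivity⟩
    linarith)
  simpa using this

/-- The orthogonal complement of a maximal orthonormal negative family is nonnegative. -/
lemma IsNegOrthonormal.nonneg_of_negInd_eq {B : E →ₗ[ℂ] E →ₗ⋆[ℂ] ℂ} (hB : IsHermForm B) {m : ℕ}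
    {v : Fin m → E} (hv : IsNegOrthonormal B v) (hm : negInd B = m) {y : E}
    (hy : ∀ i, B y (v i) = 0) : 0 ≤ (B y y).re := by
  by_contra! h
  obtain ⟨c, hc⟩ := hv.snoc hB hy h
  have := hc.le_negInd
  rw [hm, Nat.cast_le] at this
  omega

/-- A form of finite index `m` is nonnegative on the kernel of a linear map to `ℂᵐ`. -/
lemma exists_nonneg_on_ker {B : E →ₗ[ℂ] E →ₗ⋆[ℂ] ℂ} (hB : IsHermForm B) {m : ℕ}
    (hm : negInd B = m) :
    ∃ φ : E →ₗ[ℂ] (Fin m → ℂ), ∀ y, φ y = 0 → 0 ≤ (B y y).re := by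
  obtain ⟨v, hv⟩ := exists_isNegOrthonormal hB hm.ge
  exact ⟨LinearMap.pi fun i => B.flip (v i),
    fun y hy => hv.nonneg_of_negInd_eq hB hm fun i => congrFun hy i⟩

/-- The Cauchy-Schwarz inequality for a vector and a direction on which the form is nonnegative. -/
lemma norm_sq_le_of_nonneg {B : E →ₗ[ℂ] E →ₗ⋆[ℂ] ℂ} (hB : IsHermForm B) {y w : E}
    (hq : 0 ≤ (B w w).re) (h : ∀ c : ℂ, 0 ≤ (B (y + c • w) (y + c • w)).re) :
    ‖B y w‖ ^ 2 ≤ (B y y).re * (B w w).re := by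
  -- the test vectors `y + s B(y,w) w` with real `s` give a quadratic polynomial in `s`
  have hexp : ∀ s : ℝ, 0 ≤ (B y y).re + 2 * s * ‖B y w‖ ^ 2 +
      s ^ 2 * ‖B y w‖ ^ 2 * (B w w).re := by
    intro s
    have h1 := h ((s : ℂ) * B y w)
    have h2 : (B (y + ((s : ℂ) * B y w) • w) (y + ((s : ℂ) * B y w) • w)).re =
        (B y y).re + 2 * s * ‖B y w‖ ^ 2 + s ^ 2 * ‖B y w‖ ^ 2 * (B w w).re := by
      simp only [map_add, LinearMap.add_apply, LinearMap.map_smulₛₗ, LinearMap.smul_apply,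
        smul_eq_mul, hB y w, RingHom.id_apply, map_mul, Complex.conj_ofReal, Complex.star_def]
      rw [Complex.sq_norm, Complex.normSq_apply]
      have him : (B w w).im = 0 := by
        have := congrArg Complex.im (hB w w)
        simp at this
        linarith
      simp [him]
      ring
    linarith
  rcases eq_or_ne (‖B y w‖) 0 with h0 | h0
  · rw [h0]
    have h3 : 0 ≤ (B y y).re := by simpa using hexp 0
    simpa using mul_nonneg h3 hq
  have hp : 0 < ‖B y w‖ ^ 2 := by positivity
  rcases hq.eq_or_lt with hq0 | hq0
  · have h2 := hexp (-(1 + (B y y).re) / ‖B y w‖ ^ 2)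
    rw [← hq0] at h2
    have h5 : -(1 + (B y y).re) / ‖B y w‖ ^ 2 * ‖B y w‖ ^ 2 = -(1 + (B y y).re) := by field_simp
    have h3 : 0 ≤ (B y y).re := by simpa using hexp 0
    nlinarith
  · have h2 := hexp (-1 / (B w w).re)
    have : (B y y).re + 2 * (-1 / (B w w).re) * ‖B y w‖ ^ 2 +
      (-1 / (B w w).re) ^ 2 * ‖B y w‖ ^ 2 * (B w w).re =
        ((B y y).re * (B w w).re - ‖B y w‖ ^ 2) / (B w w).re := by
      field_simp
      ring
    rw [this] at h2
    have := (le_div_iff₀ hq0).1 h2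
    linarith

end NegInd

/-! ### Semicontinuity of the index along a linear pencil of forms -/

section Pencil

variable {E : Type*} [AddCommGroup E] [Module ℂ E]

/-- The length of a vector measured by a nonnegative form. -/
noncomputable def formNorm (S : E →ₗ[ℂ] E →ₗ⋆[ℂ] ℂ) (y : E) : ℝ := √(S y y).re

lemma IsHermForm.add_smul {S R : E →ₗ[ℂ] E →ₗ⋆[ℂ] ℂ} (hS : IsHermForm S) (hR : IsHermForm R)
    (l : ℝ) : IsHermForm (S + (l : ℂ) • R) := by
  intro y z
  simp [hS y z, hR y z]

lemma re_add_smul_apply (S R : E →ₗ[ℂ] E →ₗ⋆[ℂ] ℂ) (l : ℝ) (y z : E) :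
    ((S + (l : ℂ) • R) y z).re = (S y z).re + l * (R y z).re := by
  simp

/-- A lower bound for the negative index is stable under a small change of the parameter. -/
lemma eventually_le_negInd {S R : E →ₗ[ℂ] E →ₗ⋆[ℂ] ℂ} (hS : IsHermForm S) (hR : IsHermForm R)
    {K : ℝ} (hK : 0 ≤ K) (hRb : ∀ y z, ‖R y z‖ ≤ K * (formNorm S y * formNorm S z)) {l₀ : ℝ} {m : ℕ}
    (hm : (m : ℕ∞) ≤ negInd (S + (l₀ : ℂ) • R)) :
    ∀ᶠ l : ℝ in 𝓝 l₀, (m : ℕ∞) ≤ negInd (S + (l : ℂ) • R) := by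
  obtain ⟨v, hv⟩ := exists_isNegOrthonormal (hS.add_smul hR l₀) hm
  set σ := formNorm S
  set M := ∑ i, σ (v i) ^ 2 with hM
  have hM0 : 0 ≤ M := Finset.sum_nonneg fun _ _ => sq_nonneg _
  have hRv : ∀ c : Fin m → ℂ, |(R (∑ i, c i • v i) (∑ i, c i • v i)).re| ≤
      K * M * ∑ i, ‖c i‖ ^ 2 := by
    intro c
    have h1 : ‖R (∑ i, c i • v i) (∑ i, c i • v i)‖ ≤ K * (∑ i, ‖c i‖ * σ (v i)) ^ 2 := by
      rw [map_sum, sq, Finset.sum_mul_sum, Finset.mul_sum]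
      refine (norm_sum_le _ _).trans (Finset.sum_le_sum fun i _ => ?_)
      rw [map_sum, LinearMap.sum_apply, Finset.mul_sum]
      refine (norm_sum_le _ _).trans (Finset.sum_le_sum fun j _ => ?_)
      simp only [LinearMap.map_smulₛₗ, LinearMap.smul_apply, smul_eq_mul, norm_mul,
        RingHom.id_apply, RCLike.norm_conj]
      calc ‖c i‖ * (‖c j‖ * ‖R (v j) (v i)‖)
          ≤ ‖c i‖ * (‖c j‖ * (K * (σ (v j) * σ (v i)))) := by gcongr; exact hRb _ _
        _ = _ := by ring
    have h2 : (∑ i, ‖c i‖ * σ (v i)) ^ 2 ≤ (∑ i, ‖c i‖ ^ 2) * M :=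
      Finset.sum_mul_sq_le_sq_mul_sq _ _ _
    calc _ ≤ _ := Complex.abs_re_le_norm _
      _ ≤ _ := h1
      _ ≤ K * ((∑ i, ‖c i‖ ^ 2) * M) := by gcongr
      _ = _ := by ring
  filter_upwards [Metric.ball_mem_nhds l₀ (show (0 : ℝ) < 1 / (K * M + 1) by positivity)]
    with l hl
  have hl' : |l - l₀| * (K * M) < 1 := by
    have h1 : |l - l₀| < 1 / (K * M + 1) := by simpa [Real.dist_eq] using hl
    have h2 : |l - l₀| * (K * M + 1) < 1 := (lt_div_iff₀ (by positivity)).1 h1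
    nlinarith [abs_nonneg (l - l₀)]
  have := finrank_le_negInd (S + (l : ℂ) • R) (Fintype.linearCombination ℂ v) (fun c hc => by
    rw [Fintype.linearCombination_apply]
    have h1 := hv.apply_sum_sum c
    rw [re_add_smul_apply] at h1 ⊢
    obtain ⟨i, hi⟩ := Function.ne_iff.1 hc
    have hpos : 0 < ∑ i, ‖c i‖ ^ 2 :=
      Finset.sum_pos' (fun _ _ => by positivity) ⟨i, Finset.mem_univ _, by
        have := norm_pos_iff.2 hi
        positivity⟩
    have h2 : (l - l₀) * (R (∑ i, c i • v i) (∑ i, c i • v i)).re ≤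
        |l - l₀| * (K * M * ∑ i, ‖c i‖ ^ 2) := by
      refine (le_abs_self _).trans ?_
      rw [abs_mul]
      gcongr
      exact hRv c
    nlinarith)
  simpa using this

/-- Upper semicontinuity of the negative index of the pencil `S + l R` up to a defect of one. The
hypothesis on `ℓ` is a quantitative form of the statement that no nonzero vector of the kernel
of `ℓ` lies in the kernel of `S + l₀ R`. -/
lemma eventually_negInd_le {S R : E →ₗ[ℂ] E →ₗ⋆[ℂ] ℂ} (hS : IsHermForm S) (hR : IsHermForm R)
    (hpos : ∀ y, 0 ≤ (S y y).re) (hSb : ∀ y z, ‖S y z‖ ≤ formNorm S y * formNorm S z)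
    {K : ℝ} (hK : 0 ≤ K) (hRb : ∀ y z, ‖R y z‖ ≤ K * (formNorm S y * formNorm S z)) {l₀ : ℝ}
    {ℓ : E →ₗ[ℂ] ℂ} {C : ℝ} (hC : 0 ≤ C)
    (hℓ : ∀ y, ℓ y = 0 → ∃ z, (S z z).re ≤ ((S + (l₀ : ℂ) • R) y z).re ∧
      (S y y).re ≤ C * ((S + (l₀ : ℂ) • R) y z).re)
    {m : ℕ} (hm : negInd (S + (l₀ : ℂ) • R) = m) :
    ∀ᶠ l : ℝ in 𝓝 l₀, negInd (S + (l : ℂ) • R) ≤ (m + 1 : ℕ) := by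
  set B := S + (l₀ : ℂ) • R with hBdef
  have hB : IsHermForm B := hS.add_smul hR l₀
  obtain ⟨v, hv⟩ := exists_isNegOrthonormal hB hm.ge
  set σ := formNorm S with hσ
  have hσsq : ∀ y, σ y ^ 2 = (S y y).re := fun y => Real.sq_sqrt (hpos y)
  set K₁ := 1 + |l₀| * K with hK₁
  have hK₁0 : 0 ≤ K₁ := by positivity
  have hBb : ∀ y z, ‖B y z‖ ≤ K₁ * (σ y * σ z) := by
    intro y z
    calc ‖B y z‖ = ‖S y z + (l₀ : ℂ) * R y z‖ := by simp [hBdef]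
      _ ≤ ‖S y z‖ + ‖(l₀ : ℂ) * R y z‖ := norm_add_le _ _
      _ = ‖S y z‖ + |l₀| * ‖R y z‖ := by rw [norm_mul, Complex.norm_real, Real.norm_eq_abs]
      _ ≤ σ y * σ z + |l₀| * (K * (σ y * σ z)) := by
        gcongr
        · exact hSb y z
        · exact hRb y z
      _ = _ := by rw [hK₁]; ring
  set K₂ := K₁ + K₁ ^ 2 * ∑ i, σ (v i) ^ 2 with hK₂
  have hK₂0 : 0 ≤ K₂ := by positivity
  -- on the orthogonal complement of the family, intersected with the kernel of `ℓ`,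
  -- the form is bounded below by a multiple of `S`
  have coercive : ∀ y, (∀ i, B y (v i) = 0) → ℓ y = 0 →
      0 ≤ (B y y).re ∧ (S y y).re ≤ C * K₂ * (B y y).re := by
    intro y hyv hyℓ
    have hq : 0 ≤ (B y y).re := hv.nonneg_of_negInd_eq hB hm hyv
    refine ⟨hq, ?_⟩
    obtain ⟨z, hz1, hz2⟩ := hℓ y hyℓ
    -- the component `w` of `z` orthogonal to the family
    set w := z + ∑ i, B z (v i) • v i with hw
    have hwv : ∀ j, B w (v j) = 0 := by
      intro j
      rw [hw, map_add, LinearMap.add_apply, hv.apply_sum_left, add_neg_cancel]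
    have hyw : B y w = B y z := by
      rw [hw, map_add, map_sum]
      simp [LinearMap.map_smulₛₗ, hyv]
    have hww : (B w w).re ≤ K₂ * σ z ^ 2 := by
      have h1 : B w w = B z z + ∑ i, star (B z (v i)) * B z (v i) := by
        have h2 : B w w = B w z := by
          have h3 : B w (z + ∑ i, B z (v i) • v i) = B w z := by
            rw [map_add, map_sum]
            simp [LinearMap.map_smulₛₗ, hwv]
          exact h3
        rw [h2, hB z w, hw]
        simp only [map_add, map_sum, LinearMap.map_smulₛₗ, smul_eq_mul, star_add]
        rw [← hB z z, star_sum]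
        simp [mul_comm]
      have h3 : ∀ i, (star (B z (v i)) * B z (v i)).re ≤ K₁ ^ 2 * σ z ^ 2 * σ (v i) ^ 2 := by
        intro i
        rw [Complex.star_def, Complex.conj_mul']
        norm_cast
        calc ‖B z (v i)‖ ^ 2 ≤ (K₁ * (σ z * σ (v i))) ^ 2 := by gcongr; exact hBb _ _
          _ = _ := by ring
      have h4 : (B z z).re ≤ K₁ * (σ z * σ z) := (Complex.re_le_norm _).trans (hBb z z)
      rw [h1, Complex.add_re, Complex.re_sum]
      have h5 := Finset.sum_le_sum fun i (_ : i ∈ Finset.univ) => h3 i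
      rw [← Finset.mul_sum] at h5
      rw [hK₂]
      nlinarith
    have hperp : ∀ c : ℂ, 0 ≤ (B (y + c • w) (y + c • w)).re := fun c =>
      hv.nonneg_of_negInd_eq hB hm fun i => by simp [hyv, hwv]
    have hcs := norm_sq_le_of_nonneg hB (hv.nonneg_of_negInd_eq hB hm hwv) hperp
    rw [hyw] at hcs
    set h2 := (B y z).re with hh2
    have h20 : 0 ≤ h2 := (hpos z).trans hz1
    have h6 : h2 ^ 2 ≤ ‖B y z‖ ^ 2 := by
      gcongr
      exact Complex.re_le_norm _
    have h7 : h2 ^ 2 ≤ (B y y).re * (K₂ * h2) := by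
      refine h6.trans (hcs.trans ?_)
      gcongr
      refine hww.trans ?_
      gcongr
      rw [hσsq]
      exact hz1
    have h8 : h2 ≤ K₂ * (B y y).re := by
      rcases h20.eq_or_lt with h0 | h0
      · rw [← h0]; positivity
      · nlinarith
    calc _ ≤ C * h2 := hz2
      _ ≤ C * (K₂ * (B y y).re) := by gcongr
      _ = _ := by ring
  filter_upwards [Metric.ball_mem_nhds l₀ (show (0 : ℝ) < 1 / (K * (C * K₂) + 1) by positivity)]
    with l hl
  have hl' : |l - l₀| * (K * (C * K₂)) ≤ 1 := by
    have h1 : |l - l₀| < 1 / (K * (C * K₂) + 1) := by simpa [Real.dist_eq] using hl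
    have h2 : |l - l₀| * (K * (C * K₂) + 1) < 1 := (lt_div_iff₀ (by positivity)).1 h1
    nlinarith [abs_nonneg (l - l₀)]
  let φ : E →ₗ[ℂ] (Fin m → ℂ) × ℂ := (LinearMap.pi fun i => B.flip (v i)).prod ℓ
  have := negInd_le_finrank (S + (l : ℂ) • R) φ (fun y hy => by
    obtain ⟨hy1, hy2⟩ := Prod.mk.inj (hy : (_, _) = ((0, 0) : (Fin m → ℂ) × ℂ))
    obtain ⟨hq, hc⟩ := coercive y (fun i => congrFun hy1 i) hy2
    have h1 : (B y y).re = (S y y).re + l₀ * (R y y).re := re_add_smul_apply _ _ _ _ _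
    rw [re_add_smul_apply]
    have h2 : |(R y y).re| ≤ K * (S y y).re := by
      refine (Complex.abs_re_le_norm _).trans ((hRb y y).trans_eq ?_)
      rw [← hσsq, hσ]
      ring
    have h3 : -((l - l₀) * (R y y).re) ≤ |l - l₀| * (K * (C * K₂ * (B y y).re)) := by
      refine (neg_le_abs _).trans ?_
      rw [abs_mul]
      gcongr
      refine h2.trans ?_
      gcongr
    nlinarith)
  simpa using this

end Pencil

/-! ### The discrete renewal theorem -/

section Renewal

variable {ι : Type*} {K : Finset ι} {p : ι → ℝ} {m : ι → ℕ}

/-- The characteristic power series `1 - ∑ p_k X^{m_k}` of a linear recursion. -/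
noncomputable def recSeries (K : Finset ι) (p : ι → ℝ) (m : ι → ℕ) : PowerSeries ℝ :=
  1 - ∑ k ∈ K, PowerSeries.C (p k) * PowerSeries.X ^ m k

/-- The renewal sequence `u_i = δ_{i0} + ∑ p_k u_{i - m_k}`, read off from its generating
function. -/
noncomputable def renewalSeq (K : Finset ι) (p : ι → ℝ) (m : ι → ℕ) (i : ℕ) : ℝ :=
  PowerSeries.coeff i (recSeries K p m)⁻¹

lemma coeff_recSeries_mul (f : PowerSeries ℝ) (i : ℕ) :
    PowerSeries.coeff i (recSeries K p m * f) = PowerSeries.coeff i f -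
      ∑ k ∈ K, if m k ≤ i then p k * PowerSeries.coeff (i - m k) f else 0 := by
  rw [recSeries, sub_mul, one_mul, map_sub, Finset.sum_mul, map_sum]
  congr 1
  refine Finset.sum_congr rfl fun k _ => ?_
  rw [mul_assoc, PowerSeries.coeff_C_mul, PowerSeries.coeff_X_pow_mul']
  split_ifs <;> simp

lemma recSeries_mul_inv (hm : ∀ k ∈ K, 1 ≤ m k) :
    recSeries K p m * (recSeries K p m)⁻¹ = 1 := by
  refine PowerSeries.mul_inv_cancel _ ?_
  rw [recSeries, map_sub, map_sum, map_one, Finset.sum_eq_zero, sub_zero]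
  · exact one_ne_zero
  · intro k hk
    have := hm k hk
    simp [zero_pow (show m k ≠ 0 by omega)]

lemma renewalSeq_eq (hm : ∀ k ∈ K, 1 ≤ m k) (i : ℕ) :
    renewalSeq K p m i = (if i = 0 then 1 else 0) +
      ∑ k ∈ K, if m k ≤ i then p k * renewalSeq K p m (i - m k) else 0 := by
  have h := coeff_recSeries_mul (K := K) (p := p) (m := m) (recSeries K p m)⁻¹ i
  rw [recSeries_mul_inv hm, PowerSeries.coeff_one] at h
  unfold renewalSeq
  rw [h]
  ring

/-- The solution of the inhomogeneous recursion is the convolution of the right-hand side with the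
renewal sequence. -/
lemma eq_sum_renewalSeq (hm : ∀ k ∈ K, 1 ≤ m k) {b Y : ℕ → ℝ}
    (hY : ∀ i, Y i = b i + ∑ k ∈ K, if m k ≤ i then p k * Y (i - m k) else 0) (i : ℕ) :
    Y i = ∑ l ∈ Finset.range (i + 1), b l * renewalSeq K p m (i - l) := by
  have h1 : recSeries K p m * PowerSeries.mk Y = PowerSeries.mk b := by
    ext i
    rw [coeff_recSeries_mul]
    simp only [PowerSeries.coeff_mk]
    rw [hY i]
    ring
  have h2 : PowerSeries.mk Y = PowerSeries.mk b * (recSeries K p m)⁻¹ := by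
    rw [← h1, mul_right_comm, recSeries_mul_inv hm, one_mul]
  have h3 := congrArg (PowerSeries.coeff i) h2
  rw [PowerSeries.coeff_mul, Finset.Nat.sum_antidiagonal_eq_sum_range_succ_mk] at h3
  simpa [renewalSeq] using h3

variable (hp : ∀ k ∈ K, 0 < p k) (hsum : ∑ k ∈ K, p k = 1) (hm : ∀ k ∈ K, 1 ≤ m k)

include hp hm in
lemma renewalSeq_nonneg (i : ℕ) : 0 ≤ renewalSeq K p m i := by
  induction i using Nat.strong_induction_on with
  | _ i ih =>
    rw [renewalSeq_eq hm]
    refine add_nonneg (by split_ifs <;> norm_num) (Finset.sum_nonneg fun k hk => ?_)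
    split_ifs with h
    · exact mul_nonneg (hp k hk).le (ih _ (by have := hm k hk; omega))
    · exact le_rfl

include hp hsum hm in
lemma renewalSeq_le_one (i : ℕ) : renewalSeq K p m i ≤ 1 := by
  induction i using Nat.strong_induction_on with
  | _ i ih =>
    rw [renewalSeq_eq hm]
    rcases Nat.eq_zero_or_pos i with rfl | hi
    · rw [Finset.sum_eq_zero]
      · simp
      · intro k hk
        have := hm k hk
        rw [if_neg (by omega)]
    · rw [if_neg (by omega), zero_add, ← hsum]
      refine Finset.sum_le_sum fun k hk => ?_
      split_ifs with h
      · have := ih (i - m k) (by have := hm k hk; omega)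
        nlinarith [hp k hk]
      · exact (hp k hk).le

include hp hm in
/-- Positivity propagates along the semigroup generated by the `m_k`. -/
lemma exists_mul_renewalSeq_le {s : ℕ} (hs : s ∈ AddSubmonoid.closure (m '' K)) :
    ∃ w > 0, ∀ i, w * renewalSeq K p m i ≤ renewalSeq K p m (i + s) := by
  induction hs using AddSubmonoid.closure_induction with
  | mem s hs =>
    obtain ⟨k, hk, rfl⟩ := hs
    refine ⟨p k, hp k hk, fun i => ?_⟩
    rw [renewalSeq_eq hm (i + m k)]
    have h1 := Finset.single_le_sum (f := fun k' => if m k' ≤ i + m k then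
      p k' * renewalSeq K p m (i + m k - m k') else 0) (fun k' hk' => by
        split_ifs
        · exact mul_nonneg (hp k' hk').le (renewalSeq_nonneg hp hm _)
        · exact le_rfl) hk
    simp only [Nat.le_add_left, if_true, Nat.add_sub_cancel] at h1
    have : (0 : ℝ) ≤ if i + m k = 0 then 1 else 0 := by split_ifs <;> norm_num
    linarith
  | zero => exact ⟨1, one_pos, fun i => by simp⟩
  | add s t _ _ hs ht =>
    obtain ⟨w, hw, h1⟩ := hs
    obtain ⟨w', hw', h2⟩ := ht
    refine ⟨w' * w, by positivity, fun i => ?_⟩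
    have h3 := h2 (i + s)
    have h4 := mul_le_mul_of_nonneg_left (h1 i) hw'.le
    rw [← add_assoc]
    linarith

include hp hsum in
/-- The minimum principle for a recursion by convex combinations. -/
lemma le_of_le_on_window {L : ℕ} (hL : ∀ k ∈ K, m k ≤ L) (hm : ∀ k ∈ K, 1 ≤ m k) {u : ℕ → ℝ}
    (hu : ∀ i, L ≤ i → u i = ∑ k ∈ K, p k * u (i - m k)) {c : ℝ} {j : ℕ}
    (hc : ∀ l, j ≤ l → l < j + L → c ≤ u l) (l : ℕ) (hl : j ≤ l) : c ≤ u l := by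
  induction l using Nat.strong_induction_on with
  | _ l ih =>
    by_cases h : l < j + L
    · exact hc l hl h
    · rw [hu l (by omega)]
      calc c = ∑ k ∈ K, p k * c := by rw [← Finset.sum_mul, hsum, one_mul]
        _ ≤ _ := Finset.sum_le_sum fun k hk => by
          have h1 := hL k hk
          have h2 := hm k hk
          exact mul_le_mul_of_nonneg_left (ih _ (by omega) (by omega)) (hp k hk).le

include hp hsum in
/-- A value above the lower bound `c` propagates along the semigroup generated by the `m_k`. -/
lemma exists_weight {L : ℕ} (hL : ∀ k ∈ K, m k ≤ L) {s : ℕ}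
    (hs : s ∈ AddSubmonoid.closure (m '' K)) :
    ∃ w > 0, ∀ u : ℕ → ℝ, (∀ i, L ≤ i → u i = ∑ k ∈ K, p k * u (i - m k)) → ∀ (c : ℝ) (j : ℕ),
      (∀ l, j ≤ l → c ≤ u l) → ∀ i, j + L ≤ i → w * (u i - c) ≤ u (i + s) - c := by
  induction hs using AddSubmonoid.closure_induction with
  | mem s hs =>
    obtain ⟨k, hk, rfl⟩ := hs
    refine ⟨p k, hp k hk, fun u hu c j hc i hi => ?_⟩
    have h0 : u (i + m k) - c = ∑ k' ∈ K, p k' * (u (i + m k - m k') - c) := by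
      rw [hu _ (by omega)]
      simp_rw [mul_sub]
      rw [Finset.sum_sub_distrib, ← Finset.sum_mul, hsum, one_mul]
    have h1 := Finset.single_le_sum (f := fun k' => p k' * (u (i + m k - m k') - c))
      (fun k' hk' => mul_nonneg (hp k' hk').le
        (sub_nonneg.2 (hc _ (by have := hL k' hk'; omega)))) hk
    simp only [Nat.add_sub_cancel] at h1
    linarith
  | zero => exact ⟨1, one_pos, fun u _ c j _ i _ => by simp⟩
  | add s t _ _ hs ht =>
    obtain ⟨w, hw, h1⟩ := hs
    obtain ⟨w', hw', h2⟩ := ht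
    refine ⟨w' * w, by positivity, fun u hu c j hc i hi => ?_⟩
    have h3 := h2 u hu c j hc (i + s) (by omega)
    have h4 := mul_le_mul_of_nonneg_left (h1 u hu c j hc i hi) hw'.le
    rw [← add_assoc]
    linarith

/-- A positive lower bound for finitely many positive weights. -/
lemma exists_pos_le_window {w : ℕ → ℝ} {T L : ℕ} (hw : ∀ s, T ≤ s → 0 < w s) :
    ∃ ε > 0, ε ≤ 1 ∧ ∀ s, T ≤ s → s < T + L → ε ≤ w s := by
  induction L with
  | zero => exact ⟨1, one_pos, le_rfl, fun s h1 h2 => by omega⟩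
  | succ L ih =>
    obtain ⟨ε, hε, h1, hle⟩ := ih
    refine ⟨min ε (w (T + L)), lt_min hε (hw _ (by omega)), (min_le_left _ _).trans h1,
      fun s hs1 hs2 => ?_⟩
    rcases Nat.lt_succ_iff_lt_or_eq.1 (show s < (T + L) + 1 by omega) with h | rfl
    · exact (min_le_left _ _).trans (hle s hs1 h)
    · exact min_le_right _ _

include hp hsum in
/-- A bounded solution of an aperiodic recursion by convex combinations converges: over a fixed
number of steps its oscillation shrinks by a fixed factor. -/
lemma tendsto_of_recursion {L : ℕ} (hL : ∀ k ∈ K, m k ≤ L) (hm : ∀ k ∈ K, 1 ≤ m k)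
    {T : ℕ} (hT : ∀ s, T ≤ s → s ∈ AddSubmonoid.closure (m '' K)) {u : ℕ → ℝ}
    (hu : ∀ i, L ≤ i → u i = ∑ k ∈ K, p k * u (i - m k)) {c₀ A₀ : ℝ}
    (hbd : ∀ i, c₀ ≤ u i ∧ u i ≤ A₀) : ∃ x, Tendsto u atTop (𝓝 x) := by
  have hw : ∀ s, ∃ w : ℝ, T ≤ s → 0 < w ∧
      ∀ u : ℕ → ℝ, (∀ i, L ≤ i → u i = ∑ k ∈ K, p k * u (i - m k)) → ∀ (c : ℝ) (j : ℕ),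
      (∀ l, j ≤ l → c ≤ u l) → ∀ i, j + L ≤ i → w * (u i - c) ≤ u (i + s) - c := by
    intro s
    by_cases h : T ≤ s
    · obtain ⟨w, hw, h1⟩ := exists_weight hp hsum hL (hT s h)
      exact ⟨w, fun _ => ⟨hw, h1⟩⟩
    · exact ⟨0, fun h' => absurd h' h⟩
  choose w hw using hw
  obtain ⟨ε, hε, hε1, hεw⟩ := exists_pos_le_window (L := L) fun s hs => (hw s hs).1
  -- one step of the contraction, for a value above the midpoint
  have step : ∀ u : ℕ → ℝ, (∀ i, L ≤ i → u i = ∑ k ∈ K, p k * u (i - m k)) → ∀ (c A : ℝ) (j : ℕ),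
      (∀ l, j ≤ l → c ≤ u l) → (c + A) / 2 ≤ u (j + L) →
      ∀ l, j + L + T ≤ l → c + ε / 2 * (A - c) ≤ u l := by
    intro u hu c A j hc hmid
    refine le_of_le_on_window hp hsum hL hm hu fun l hl1 hl2 => ?_
    obtain ⟨s, rfl⟩ := Nat.exists_eq_add_of_le (show j + L ≤ l by omega)
    have hsT : T ≤ s := by omega
    have h1 := (hw s hsT).2 u hu c j hc (j + L) le_rfl
    have h2 := hεw s hsT (by omega)
    have h3 : 0 ≤ u (j + L) - c := sub_nonneg.2 (hc _ (by omega))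
    have h4 := mul_le_mul_of_nonneg_right h2 h3
    nlinarith
  have key : ∀ n : ℕ, ∃ (j : ℕ) (c A : ℝ), A - c ≤ (1 - ε / 2) ^ n * (A₀ - c₀) ∧
      ∀ l, j ≤ l → c ≤ u l ∧ u l ≤ A := by
    intro n
    induction n with
    | zero => exact ⟨0, c₀, A₀, by simp, fun l _ => hbd l⟩
    | succ n ih =>
      obtain ⟨j, c, A, hcA, hb⟩ := ih
      have hlen : (1 - ε / 2) * (A - c) ≤ (1 - ε / 2) ^ (n + 1) * (A₀ - c₀) := by
        rw [pow_succ', mul_assoc]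
        exact mul_le_mul_of_nonneg_left hcA (by linarith)
      rcases le_total ((c + A) / 2) (u (j + L)) with h | h
      · exact ⟨j + L + T, c + ε / 2 * (A - c), A, by linarith, fun l hl =>
          ⟨step u hu c A j (fun l hl => (hb l hl).1) h l hl, (hb l (by omega)).2⟩⟩
      · refine ⟨j + L + T, c, A - ε / 2 * (A - c), by linarith, fun l hl =>
          ⟨(hb l (by omega)).1, ?_⟩⟩
        have := step (fun i => -u i) (fun i hi => by simp [hu i hi]) (-A) (-c) j
          (fun l hl => neg_le_neg (hb l hl).2) (by linarith) l hl
        linarith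
  have hcauchy : CauchySeq u := by
    refine Metric.cauchySeq_iff.2 fun δ hδ => ?_
    have hlim : Tendsto (fun n : ℕ => (1 - ε / 2) ^ n * (A₀ - c₀)) atTop (𝓝 0) := by
      simpa using (tendsto_pow_atTop_nhds_zero_of_lt_one (show 0 ≤ 1 - ε / 2 by linarith)
        (by linarith)).mul_const (A₀ - c₀)
    obtain ⟨n, hn⟩ := (hlim.eventually (gt_mem_nhds hδ)).exists
    obtain ⟨j, c, A, hcA, hb⟩ := key n
    refine ⟨j, fun i hi l hl => ?_⟩
    rw [Real.dist_eq, abs_lt]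
    have h1 := hb i hi
    have h2 := hb l hl
    constructor <;> linarith
  exact cauchySeq_tendsto_of_complete hcauchy

include hp hsum hm in
/-- The renewal sequence of an aperiodic recursion has a positive limit. -/
lemma exists_tendsto_renewalSeq {T : ℕ}
    (hT : ∀ s, T ≤ s → s ∈ AddSubmonoid.closure (m '' K)) :
    ∃ x > 0, Tendsto (renewalSeq K p m) atTop (𝓝 x) := by
  obtain ⟨L, hL⟩ : ∃ L, ∀ k ∈ K, m k ≤ L := ⟨∑ k ∈ K, m k, fun k hk =>
    Finset.single_le_sum (f := m) (fun _ _ => Nat.zero_le _) hk⟩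
  have hrec : ∀ i, L + 1 ≤ i → renewalSeq K p m i =
      ∑ k ∈ K, p k * renewalSeq K p m (i - m k) := by
    intro i hi
    rw [renewalSeq_eq hm, if_neg (by omega), zero_add]
    exact Finset.sum_congr rfl fun k hk => if_pos (by have := hL k hk; omega)
  have hL' : ∀ k ∈ K, m k ≤ L + 1 := fun k hk => (hL k hk).trans (Nat.le_succ L)
  obtain ⟨x, hx⟩ := tendsto_of_recursion hp hsum hL' hm hT hrec (c₀ := 0) (A₀ := 1)
    fun i => ⟨renewalSeq_nonneg hp hm i, renewalSeq_le_one hp hsum hm i⟩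
  have hzero : renewalSeq K p m 0 = 1 := by
    rw [renewalSeq_eq hm, Finset.sum_eq_zero]
    · simp
    · intro k hk
      have := hm k hk
      rw [if_neg (by omega)]
  have hpos : ∀ s, T ≤ s → 0 < renewalSeq K p m s := by
    intro s hs
    obtain ⟨w, hw, h⟩ := exists_mul_renewalSeq_le hp hm (hT s hs)
    have := h 0
    rw [hzero, zero_add, mul_one] at this
    linarith
  obtain ⟨ε, hε, -, hεle⟩ := exists_pos_le_window (L := L + 1) hpos
  have hge := le_of_le_on_window hp hsum hL' hm hrec hεle
  exact ⟨x, hε.trans_le (ge_of_tendsto hx (eventually_atTop.2 ⟨T, hge⟩)), hx⟩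

include hp hsum hm in
/-- The discrete renewal theorem, uniformly over all right-hand sides with a common geometric
bound. -/
theorem renewal_uniform {T : ℕ} (hT : ∀ s, T ≤ s → s ∈ AddSubmonoid.closure (m '' K))
    {C q : ℝ} (hq0 : 0 ≤ q) (hq1 : q < 1) :
    ∃ x > 0, ∃ e : ℕ → ℝ, Tendsto e atTop (𝓝 0) ∧ ∀ b Y : ℕ → ℝ,
      (∀ i, 0 ≤ b i ∧ b i ≤ C * q ^ i) →
      (∀ i, Y i = b i + ∑ k ∈ K, if m k ≤ i then p k * Y (i - m k) else 0) →
      ∀ i, |Y i - x * ∑' l, b l| ≤ e i := by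
  obtain ⟨x, hx, hlim⟩ := exists_tendsto_renewalSeq hp hsum hm hT
  set v : ℕ → ℕ → ℝ := fun i l => if l ≤ i then renewalSeq K p m (i - l) else 0 with hv
  have hv01 : ∀ i l, |v i l - x| ≤ 1 + x := by
    intro i l
    have h1 := renewalSeq_nonneg hp hm (i - l)
    have h2 := renewalSeq_le_one hp hsum hm (i - l)
    simp only [hv]
    rw [abs_le]
    split_ifs <;> constructor <;> linarith
  have hgeo : Summable fun l : ℕ => C * q ^ l := (summable_geometric_of_lt_one hq0 hq1).mul_left C
  have habs : ∀ l, |C * q ^ l| = |C| * q ^ l := fun l => by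
    rw [abs_mul, abs_of_nonneg (pow_nonneg hq0 l)]
  have hbound : Summable fun l : ℕ => |C| * q ^ l * (1 + x) :=
    ((summable_geometric_of_lt_one hq0 hq1).mul_left |C|).mul_right _
  refine ⟨x, hx, fun i => ∑' l, |C| * q ^ l * |v i l - x|, ?_, fun b Y hb hY i => ?_⟩
  · have := tendsto_tsum_of_dominated_convergence (𝓕 := atTop)
      (f := fun (i : ℕ) (l : ℕ) => |C| * q ^ l * |v i l - x|) (g := fun _ => 0) hbound
      (fun l => by
        have h1 : Tendsto (fun i => v i l) atTop (𝓝 x) := by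
          refine Tendsto.congr' ?_ (hlim.comp (tendsto_sub_atTop_nat l))
          filter_upwards [eventually_ge_atTop l] with i hi
          simp [hv, hi]
        simpa using ((h1.sub_const x).abs).const_mul (|C| * q ^ l))
      (Eventually.of_forall fun i l => by
        rw [Real.norm_of_nonneg (mul_nonneg (mul_nonneg (abs_nonneg C) (pow_nonneg hq0 l))
          (abs_nonneg _))]
        exact mul_le_mul_of_nonneg_left (hv01 i l)
          (mul_nonneg (abs_nonneg C) (pow_nonneg hq0 l)))
    simpa using this
  · have hbs : Summable b := Summable.of_nonneg_of_le (fun l => (hb l).1) (fun l => (hb l).2) hgeo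
    have hYi : HasSum (fun l => b l * v i l) (Y i) := by
      rw [eq_sum_renewalSeq hm hY i]
      have h1 : ∑ l ∈ Finset.range (i + 1), b l * renewalSeq K p m (i - l) =
          ∑ l ∈ Finset.range (i + 1), b l * v i l :=
        Finset.sum_congr rfl fun l hl => by
          have : l ≤ i := by simpa [Nat.lt_succ_iff] using hl
          simp [hv, this]
      rw [h1]
      refine hasSum_sum_of_ne_finset_zero fun l hl => ?_
      have : ¬ l ≤ i := by simpa [Nat.lt_succ_iff] using hl
      simp [hv, this]
    have h2 := hYi.sub (hbs.hasSum.mul_left x)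
    have h3 : ∀ l, ‖b l * v i l - x * b l‖ ≤ |C| * q ^ l * |v i l - x| := by
      intro l
      rw [show b l * v i l - x * b l = b l * (v i l - x) by ring, Real.norm_eq_abs, abs_mul,
        abs_of_nonneg (hb l).1]
      refine mul_le_mul_of_nonneg_right ?_ (abs_nonneg _)
      rw [← habs]
      exact (hb l).2.trans (le_abs_self _)
    rw [← h2.tsum_eq, ← Real.norm_eq_abs]
    have hs : Summable fun l => |C| * q ^ l * |v i l - x| :=
      Summable.of_nonneg_of_le (fun l => mul_nonneg (mul_nonneg (abs_nonneg C) (pow_nonneg hq0 l))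
          (abs_nonneg _)) (fun l => mul_le_mul_of_nonneg_left (hv01 i l)
          (mul_nonneg (abs_nonneg C) (pow_nonneg hq0 l))) hbound
    exact tsum_of_norm_bounded hs.hasSum h3

end Renewal

/-! ### Asymptotics of counting functions with an arithmetic recursion -/

section Counting

/-- The exponents of an arithmetic self-similarity: `a_k d_k = (-1)^{m_k} e^{-ν m_k}`, the sign
being given by the parity conditions; the `m_k` generate all large integers. -/
lemma exists_exponents {n : ℕ} {a d : Fin n → ℝ} {ν : ℝ} (ha : ∀ k, 0 < a k)
    (had : ∀ k, a k * |d k| < 1) (hν : IsArithmeticWithStep a d ν)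
    (heven : ∀ k, 0 < d k → ∃ m : ℤ, Even m ∧ Real.log (a k * |d k|) / ν = m)
    (hodd : ∀ k, d k < 0 → ∃ m : ℤ, Odd m ∧ Real.log (a k * |d k|) / ν = m) :
    ∃ m : Fin n → ℕ,
      (∀ k, d k ≠ 0 → 1 ≤ m k ∧ a k * |d k| = Real.exp (-(ν * m k)) ∧
        a k * d k = (-1) ^ m k * Real.exp (-(ν * m k))) ∧
      ∃ T, ∀ s, T ≤ s → s ∈ AddSubmonoid.closure
        (m '' (Finset.univ.filter fun k => d k ≠ 0 : Finset (Fin n))) := by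
  obtain ⟨hν0, hcl⟩ := hν
  have h1 : ∀ k, ∃ m : ℕ, d k ≠ 0 → 1 ≤ m ∧ Real.log (a k * |d k|) = -(ν * m) ∧
      a k * |d k| = Real.exp (-(ν * m)) ∧ a k * d k = (-1) ^ m * Real.exp (-(ν * m)) := by
    intro k
    by_cases hk : d k = 0
    · exact ⟨0, fun h => absurd hk h⟩
    have hpos : 0 < a k * |d k| := mul_pos (ha k) (abs_pos.2 hk)
    have hlog : Real.log (a k * |d k|) < 0 := Real.log_neg hpos (had k)
    have aux : ∀ z : ℤ, Real.log (a k * |d k|) / ν = z → ∃ m : ℕ, z = -(m : ℤ) ∧ 1 ≤ m ∧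
        Real.log (a k * |d k|) = -(ν * m) ∧ a k * |d k| = Real.exp (-(ν * m)) := by
      intro z hz
      have hz0 : (z : ℝ) < 0 := by rw [← hz]; exact div_neg_of_neg_of_pos hlog hν0
      have hz0' : z < 0 := by exact_mod_cast hz0
      have hm : z = -((-z).toNat : ℤ) := by omega
      have hl : Real.log (a k * |d k|) = -(ν * ((-z).toNat : ℕ)) := by
        have h2 := congrArg (Int.cast : ℤ → ℝ) hm
        rw [Int.cast_neg, Int.cast_natCast] at h2
        rw [div_eq_iff hν0.ne', h2] at hz
        rw [hz]
        ring
      exact ⟨(-z).toNat, hm, by omega, hl, by rw [← hl, Real.exp_log hpos]⟩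
    rcases lt_or_gt_of_ne hk with hneg | hpos'
    · obtain ⟨z, hz, hz'⟩ := hodd k hneg
      obtain ⟨m, hm, hm1, hl, he⟩ := aux z hz'
      refine ⟨m, fun _ => ⟨hm1, hl, he, ?_⟩⟩
      have : Odd m := by
        rw [hm] at hz
        exact_mod_cast (by simpa using hz : Odd (m : ℤ))
      rw [this.neg_one_pow, ← he, abs_of_neg hneg]
      ring
    · obtain ⟨z, hz, hz'⟩ := heven k hpos'
      obtain ⟨m, hm, hm1, hl, he⟩ := aux z hz'
      refine ⟨m, fun _ => ⟨hm1, hl, he, ?_⟩⟩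
      have : Even m := by
        rw [hm] at hz
        exact_mod_cast (by simpa using hz : Even (m : ℤ))
      rw [this.neg_one_pow, ← he, abs_of_pos hpos']
      ring
  choose m hm using h1
  refine ⟨m, fun k hk => ⟨(hm k hk).1, (hm k hk).2.2.1, (hm k hk).2.2.2⟩, ?_⟩
  set A : Set ℕ := m '' (Finset.univ.filter fun k => d k ≠ 0 : Finset (Fin n)) with hA
  -- the step `ν` is a multiple of `g ν`, `g` being the greatest common divisor
  have hgcd : Nat.setGcd A = 1 := by
    have hsub : {x : ℝ | ∃ k, d k ≠ 0 ∧ x = Real.log (a k * |d k|)} ⊆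
        (AddSubgroup.zmultiples ((Nat.setGcd A : ℝ) * ν) : Set ℝ) := by
      rintro x ⟨k, hk, rfl⟩
      have hmem : m k ∈ A := ⟨k, by simpa using hk, rfl⟩
      obtain ⟨c, hc⟩ := Nat.setGcd_dvd_of_mem hmem
      refine ⟨-(c : ℤ), ?_⟩
      simp only [zsmul_eq_mul]
      rw [(hm k hk).2.1, hc]
      push_cast
      ring
    have hle := (AddSubgroup.closure_le _).2 hsub
    rw [hcl] at hle
    obtain ⟨z, hz⟩ := hle (AddSubgroup.mem_zmultiples ν)
    simp only [zsmul_eq_mul] at hz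
    have hz' : ((z * (Nat.setGcd A : ℤ) : ℤ) : ℝ) = (1 : ℤ) := by
      push_cast
      have : ((z : ℝ) * (Nat.setGcd A : ℝ) - 1) * ν = 0 := by linarith
      rcases mul_eq_zero.1 this with h | h
      · linarith
      · exact absurd h hν0.ne'
    have hz'' : z * (Nat.setGcd A : ℤ) = 1 := by exact_mod_cast hz'
    have : (Nat.setGcd A : ℤ) ∣ 1 := ⟨z, by rw [mul_comm]; exact hz''.symm⟩
    exact Nat.dvd_one.1 (by exact_mod_cast this)
  obtain ⟨T, hT⟩ := Nat.exists_mem_closure_of_ge A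
  exact ⟨T, fun s hs => hT s hs (by rw [hgcd]; exact one_dvd _)⟩

/-- The counting function along the two-sided geometric progression `(-1)^i e^{ν (t + i)}`,
normalized by the expected order of growth. -/
noncomputable def normalizedCount (N : ℝ → ℕ) (ν κ t : ℝ) (i : ℕ) : ℝ :=
  Real.exp (-(κ * (t + i))) * N ((-1) ^ i * Real.exp (ν * (t + i)))

/-- The recursion of a counting function under the self-similarity, solved by the renewal theorem:
the normalized counts converge, uniformly on bounded sets, to a positive limit. -/
lemma exists_uniform_limit {n : ℕ} {a d : Fin n → ℝ} {N : ℝ → ℕ} {ν D : ℝ} {m : Fin n → ℕ}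
    (hν : 0 < ν) (hDpos : 0 < D) (hD : IsSpectralOrder a d D)
    (hm : ∀ k, d k ≠ 0 → 1 ≤ m k ∧ a k * |d k| = Real.exp (-(ν * m k)) ∧
        a k * d k = (-1) ^ m k * Real.exp (-(ν * m k)))
    {T₀ : ℕ} (hT₀ : ∀ s, T₀ ≤ s → s ∈ AddSubmonoid.closure
        (m '' (Finset.univ.filter fun k => d k ≠ 0 : Finset (Fin n))))
    (hsmall : ∃ δ > 0, ∀ l, |l| < δ → N l = 0)
    (hrec : ∀ l, ∑ k, N (a k * d k * l) ≤ N l ∧ N l ≤ ∑ k, N (a k * d k * l) + n)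
    (hlarge : (∃ c, ∀ l, c ≤ l → 1 ≤ N l) ∨ ∃ c, ∀ l, l ≤ c → 1 ≤ N l) (T : ℝ) :
    ∃ (s : ℝ → ℝ) (e : ℕ → ℝ), Tendsto e atTop (𝓝 0) ∧ ∀ t, |t| ≤ T →
      0 < s t ∧ ∀ i, |normalizedCount N ν (ν * D / 2) t i - s t| ≤ e i := by
  set κ := ν * D / 2 with hκ
  have hκ0 : 0 < κ := by positivity
  set K := Finset.univ.filter fun k => d k ≠ 0 with hK
  have hKmem : ∀ k ∈ K, d k ≠ 0 := fun k hk => by simpa [hK] using hk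
  obtain ⟨δ, hδ, hsm⟩ := hsmall
  -- the progression is started at an even index `-J` below which the count vanishes
  obtain ⟨J', hJ'⟩ : ∃ J' : ℕ, Real.exp (ν * (T - (2 * J' : ℕ))) < δ := by
    have h1 : Tendsto (fun J' : ℕ => Real.exp (ν * (T - (2 * J' : ℕ)))) atTop (𝓝 0) := by
      refine Real.tendsto_exp_atBot.comp ?_
      refine Tendsto.const_mul_atBot hν ?_
      refine tendsto_atBot_add_const_left _ T (tendsto_neg_atTop_atBot.comp ?_)
      exact tendsto_natCast_atTop_atTop.comp (tendsto_id.const_mul_atTop' (by norm_num))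
    exact (h1.eventually (gt_mem_nhds hδ)).exists
  set J := 2 * J' with hJ
  have hJe : Even J := ⟨J', by omega⟩
  set p : Fin n → ℝ := fun k => Real.exp (-(κ * m k)) with hp
  have hsum : ∑ k ∈ K, p k = 1 := by
    rw [← hD]
    refine Finset.sum_congr rfl fun k hk => ?_
    rw [(hm k (hKmem k hk)).2.1, ← Real.exp_mul]
    simp only [hp, hκ]
    congr 1
    ring
  set q := Real.exp (-κ) with hq
  have hq0 : 0 ≤ q := (Real.exp_pos _).le
  have hq1 : q < 1 := by rw [hq, Real.exp_lt_one_iff]; linarith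
  obtain ⟨x, hx, e, he, hunif⟩ := renewal_uniform (K := K) (p := p) (m := m)
    (fun k _ => Real.exp_pos _) hsum (fun k hk => (hm k (hKmem k hk)).1) hT₀
    (C := n * Real.exp (κ * (T + J))) hq0 hq1
  set σ : ℝ → ℕ → ℝ := fun t i => (-1) ^ i * Real.exp (ν * (t + i - J)) with hσ
  set Y : ℝ → ℕ → ℝ := fun t i => Real.exp (-(κ * (t + i - J))) * N (σ t i) with hY
  set b : ℝ → ℕ → ℝ := fun t i =>
    Y t i - ∑ k ∈ K, if m k ≤ i then p k * Y t (i - m k) else 0 with hb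
  have hstep : ∀ t, |t| ≤ T → ∀ i, ∑ k ∈ K, (if m k ≤ i then p k * Y t (i - m k) else 0) =
      Real.exp (-(κ * (t + i - J))) * (∑ k, N (a k * d k * σ t i) : ℕ) := by
    intro t ht i
    have h0 : ∑ k, N (a k * d k * σ t i) = ∑ k ∈ K, N (a k * d k * σ t i) := by
      refine (Finset.sum_subset (Finset.subset_univ K) fun k _ hk => ?_).symm
      have : d k = 0 := by simpa [hK] using hk
      rw [this, mul_zero, zero_mul]
      exact hsm 0 (by simpa using hδ)
    rw [h0, Nat.cast_sum, Finset.mul_sum]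
    refine Finset.sum_congr rfl fun k hk => ?_
    obtain ⟨hm1, -, hk2⟩ := hm k (hKmem k hk)
    -- the factor `a_k d_k` moves the progression by `m_k` steps, sign included
    split_ifs with h
    · have h1 : a k * d k * σ t i = σ t (i - m k) := by
        simp only [hσ]
        rw [hk2, mul_mul_mul_comm, ← Real.exp_add, Nat.cast_sub h]
        congr 1
        · obtain ⟨r, rfl⟩ := Nat.exists_eq_add_of_le h
          rw [Nat.add_sub_cancel_left, pow_add, ← mul_assoc, ← mul_pow]
          norm_num
        · congr 1
          ring
      rw [h1]
      simp only [hY, hp]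
      rw [← mul_assoc, ← Real.exp_add, Nat.cast_sub h]
      congr 2
      ring
    · have h1 : N (a k * d k * σ t i) = 0 := by
        refine hsm _ (lt_of_le_of_lt ?_ hJ')
        simp only [hσ]
        rw [hk2, mul_mul_mul_comm, ← Real.exp_add, abs_mul, ← pow_add, abs_pow, abs_neg, abs_one,
          one_pow, one_mul, Real.abs_exp, Real.exp_le_exp]
        have h2 : (i : ℝ) ≤ m k := by exact_mod_cast (not_le.1 h).le
        have h3 := (abs_le.1 ht).2
        nlinarith
      rw [h1]
      simp
  have hbb : ∀ t, |t| ≤ T → ∀ i, 0 ≤ b t i ∧ b t i ≤ n * Real.exp (κ * (T + J)) * q ^ i := by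
    intro t ht i
    have h1 : b t i = Real.exp (-(κ * (t + i - J))) *
        (N (σ t i) - (∑ k, N (a k * d k * σ t i) : ℕ)) := by
      simp only [hb]
      rw [hstep t ht i]
      ring
    obtain ⟨h2, h3⟩ := hrec (σ t i)
    have h2' : ((∑ k, N (a k * d k * σ t i) : ℕ) : ℝ) ≤ N (σ t i) := by exact_mod_cast h2
    have h3' : (N (σ t i) : ℝ) ≤ (∑ k, N (a k * d k * σ t i) : ℕ) + n := by exact_mod_cast h3
    have hE := Real.exp_pos (-(κ * (t + i - J)))
    constructor
    · rw [h1]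
      exact mul_nonneg hE.le (by linarith)
    · have h4 : Real.exp (-(κ * (t + i - J))) ≤ Real.exp (κ * (T + J)) * q ^ i := by
        rw [hq, ← Real.exp_nat_mul, ← Real.exp_add, Real.exp_le_exp]
        have := (abs_le.1 ht).1
        nlinarith
      rw [h1]
      have h5 : (N (σ t i) - (∑ k, N (a k * d k * σ t i) : ℕ) : ℝ) ≤ n := by linarith
      calc _ ≤ Real.exp (-(κ * (t + i - J))) * n := by gcongr
        _ ≤ (Real.exp (κ * (T + J)) * q ^ i) * n := by gcongr
        _ = _ := by ring
  have hYrec : ∀ t i, Y t i = b t i + ∑ k ∈ K, if m k ≤ i then p k * Y t (i - m k) else 0 := by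
    intro t i
    simp only [hb]
    ring
  have hYG : ∀ t i, Y t (i + J) = normalizedCount N ν κ t i := by
    intro t i
    simp only [hY, hσ, normalizedCount]
    rw [pow_add, hJe.neg_one_pow, mul_one]
    push_cast
    rw [show t + ((i : ℝ) + J) - J = t + i by ring]
  refine ⟨fun t => x * ∑' l, b t l, fun i => e (i + J),
    he.comp (tendsto_add_atTop_nat J), fun t ht => ⟨?_, fun i => ?_⟩⟩
  · refine mul_pos hx ?_
    have hs : Summable (b t) := Summable.of_nonneg_of_le (fun l => (hbb t ht l).1)
      (fun l => (hbb t ht l).2) ((summable_geometric_of_lt_one hq0 hq1).mul_left _)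
    -- otherwise the count would vanish along the whole progression
    by_contra hcon
    have hzero : ∀ l, b t l = 0 := by
      intro l
      have h1 := hs.le_tsum l fun j _ => (hbb t ht j).1
      have h2 := (hbb t ht l).1
      linarith
    have hYzero : ∀ i, normalizedCount N ν κ t i = 0 := by
      intro i
      rw [← hYG, eq_sum_renewalSeq (fun k hk => (hm k (hKmem k hk)).1) (hYrec t)]
      simp [hzero]
    have hNzero : ∀ i : ℕ, N ((-1) ^ i * Real.exp (ν * (t + i))) = 0 := by
      intro i
      have := hYzero i
      rw [normalizedCount, mul_eq_zero] at this
      exact_mod_cast this.resolve_left (Real.exp_pos _).ne'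
    have hinf : Tendsto (fun i : ℕ => Real.exp (ν * (t + i))) atTop atTop :=
      Real.tendsto_exp_atTop.comp (Tendsto.const_mul_atTop hν
        (tendsto_atTop_add_const_left _ t tendsto_natCast_atTop_atTop))
    rcases hlarge with ⟨c, hc⟩ | ⟨c, hc⟩
    · obtain ⟨i, hi⟩ := (hinf.eventually_ge_atTop c).exists_forall_of_atTop
      have h1 := hc _ (hi (2 * i) (by omega))
      have h2 := hNzero (2 * i)
      rw [(even_two_mul i).neg_one_pow, one_mul] at h2
      omega
    · obtain ⟨i, hi⟩ := (hinf.eventually_ge_atTop (-c)).exists_forall_of_atTop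
      have h1 := hc _ (neg_le.1 (hi (2 * i + 1) (by omega)))
      have h2 := hNzero (2 * i + 1)
      rw [(odd_two_mul_add_one i).neg_one_pow, neg_one_mul] at h2
      omega
  · rw [← hYG]
    exact hunif (b t) (Y t) (hbb t ht) (hYrec t) (i + J)

/-- The asymptotics of an integer-valued function satisfying the recursion of an arithmetic
self-similarity up to a bounded error, vanishing near zero, with bounded jumps. -/
theorem counting_asymptotics {n : ℕ} {a d : Fin n → ℝ} {N : ℝ → ℕ} {ν D : ℝ}
    (ha : ∀ k, 0 < a k) (had : ∀ k, a k * |d k| < 1) (hν : IsArithmeticWithStep a d ν)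
    (hD : IsSpectralOrder a d D) (hDpos : 0 < D)
    (heven : ∀ k, 0 < d k → ∃ m : ℤ, Even m ∧ Real.log (a k * |d k|) / ν = m)
    (hodd : ∀ k, d k < 0 → ∃ m : ℤ, Odd m ∧ Real.log (a k * |d k|) / ν = m)
    (hsmall : ∃ δ > 0, ∀ l, |l| < δ → N l = 0)
    (hrec : ∀ l, ∑ k, N (a k * d k * l) ≤ N l ∧ N l ≤ ∑ k, N (a k * d k * l) + n)
    (hjump : ∀ l₀, ∀ᶠ l in 𝓝 l₀, N l₀ ≤ N l ∧ N l ≤ N l₀ + 1)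
    (hlarge : (∃ c, ∀ l, c ≤ l → 1 ≤ N l) ∨ ∃ c, ∀ l, l ≤ c → 1 ≤ N l) :
    ∃ s : ℝ → ℝ, Continuous s ∧ (∀ t, 0 < s t) ∧ Function.Periodic s 2 ∧
      (∃ ε : ℝ → ℝ, Tendsto ε atTop (𝓝 0) ∧ ∀ l : ℝ, 0 < l →
        (N l : ℝ) = l ^ (D / 2) * (s (Real.log l / ν) + ε l)) ∧
      (∃ ε : ℝ → ℝ, Tendsto ε atBot (𝓝 0) ∧ ∀ l : ℝ, l < 0 →
        (N l : ℝ) = |l| ^ (D / 2) * (s (Real.log |l| / ν - 1) + ε l)) := by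
  obtain ⟨m, hm, T₀, hT₀⟩ := exists_exponents ha had hν heven hodd
  have hν0 := hν.1
  have hlim := exists_uniform_limit hν0 hDpos hD hm hT₀ hsmall hrec hlarge
  set κ := ν * D / 2 with hκ
  have hκ0 : 0 < κ := by positivity
  set G := normalizedCount N ν κ with hG
  have hpt : ∀ t, ∃ x > 0, Tendsto (G t) atTop (𝓝 x) := by
    intro t
    obtain ⟨s, e, he, h⟩ := hlim |t|
    obtain ⟨h1, h2⟩ := h t le_rfl
    exact ⟨s t, h1, tendsto_iff_norm_sub_tendsto_zero.2
      (squeeze_zero (fun _ => norm_nonneg _) h2 he)⟩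
  choose s hs0 hs using hpt
  have hunif : ∀ T, ∃ e : ℕ → ℝ, Tendsto e atTop (𝓝 0) ∧ ∀ t, |t| ≤ T → ∀ i,
      |G t i - s t| ≤ e i := by
    intro T
    obtain ⟨s', e, he, h⟩ := hlim T
    refine ⟨e, he, fun t ht i => ?_⟩
    obtain ⟨-, h2⟩ := h t ht
    have : s t = s' t := tendsto_nhds_unique (hs t) (tendsto_iff_norm_sub_tendsto_zero.2
      (squeeze_zero (fun _ => norm_nonneg _) h2 he))
    rw [this]
    exact h2 i
  have hper : Function.Periodic s 2 := by
    intro t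
    refine tendsto_nhds_unique (hs (t + 2)) (((hs t).comp (tendsto_add_atTop_nat 2)).congr ?_)
    intro i
    simp only [hG, normalizedCount, Function.comp_apply]
    rw [pow_add, even_two.neg_one_pow, mul_one]
    push_cast
    rw [show t + ((i : ℝ) + 2) = t + 2 + i by ring]
  have hcont : Continuous s := by
    refine continuous_iff_continuousAt.2 fun t₀ => Metric.tendsto_nhds.2 fun ε hε => ?_
    obtain ⟨e, he, hbd⟩ := hunif (|t₀| + 1)
    have hE : Tendsto (fun i : ℕ => Real.exp (-(κ * (t₀ + i)))) atTop (𝓝 0) :=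
      Real.tendsto_exp_neg_atTop_nhds_zero.comp (Tendsto.const_mul_atTop hκ0
        (tendsto_atTop_add_const_left _ t₀ tendsto_natCast_atTop_atTop))
    obtain ⟨i, hi1, hi2⟩ := ((he.eventually (gt_mem_nhds (show 0 < ε / 8 by positivity))).and
      (hE.eventually (gt_mem_nhds (show 0 < ε / 4 by positivity)))).exists
    set E : ℝ → ℝ := fun t => Real.exp (-(κ * (t + i))) with hEdef
    set σ : ℝ → ℝ := fun t => (-1) ^ i * Real.exp (ν * (t + i)) with hσdef
    have hEc : Continuous E := by fun_prop
    have hσc : Continuous σ := by fun_prop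
    have hEpos : ∀ t, 0 < E t := fun t => Real.exp_pos _
    have hGE : ∀ t, G t i = E t * N (σ t) := fun t => rfl
    have ev1 : ∀ᶠ t in 𝓝 t₀, G t₀ i - ε / 4 < E t * N (σ t₀) := by
      have : Tendsto (fun t => E t * N (σ t₀)) (𝓝 t₀) (𝓝 (G t₀ i)) := by
        rw [hGE]
        exact (hEc.tendsto t₀).mul_const _
      exact this.eventually (lt_mem_nhds (by linarith))
    have ev2 : ∀ᶠ t in 𝓝 t₀, E t * (N (σ t₀) + 1) < G t₀ i + ε / 2 := by
      have : Tendsto (fun t => E t * (N (σ t₀) + 1 : ℝ)) (𝓝 t₀) (𝓝 (G t₀ i + E t₀)) := by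
        rw [hGE, show E t₀ * N (σ t₀) + E t₀ = E t₀ * (N (σ t₀) + 1) by ring]
        exact (hEc.tendsto t₀).mul_const _
      exact this.eventually (gt_mem_nhds (by linarith))
    filter_upwards [ev1, ev2, hσc.tendsto t₀ (hjump (σ t₀)),
      Metric.ball_mem_nhds t₀ one_pos] with t h1 h2 h3 h4
    have h3' : (N (σ t₀) : ℝ) ≤ N (σ t) ∧ (N (σ t) : ℝ) ≤ N (σ t₀) + 1 := by
      obtain ⟨h5, h6⟩ := h3
      exact ⟨by exact_mod_cast h5, by exact_mod_cast h6⟩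
    have h5 : |t| ≤ |t₀| + 1 := by
      have h6 : |t - t₀| < 1 := by simpa [Real.dist_eq] using h4
      have := abs_add_le t₀ (t - t₀)
      rw [add_sub_cancel] at this
      linarith
    have h7 := abs_le.1 (hbd t h5 i)
    have h8 := abs_le.1 (hbd t₀ (by linarith) i)
    have h9 : E t * N (σ t₀) ≤ G t i := by
      rw [hGE]; exact mul_le_mul_of_nonneg_left h3'.1 (hEpos t).le
    have h10 : G t i ≤ E t * (N (σ t₀) + 1) := by
      rw [hGE]; exact mul_le_mul_of_nonneg_left h3'.2 (hEpos t).le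
    rw [Real.dist_eq, abs_lt]
    constructor <;> linarith [h7.1, h7.2, h8.1, h8.2]
  -- reduction of a large parameter modulo `2` to the interval `[0, 2)`
  have main : ∀ c : ℕ, Tendsto (fun τ : ℝ =>
      Real.exp (-(κ * τ)) * N ((-1) ^ c * Real.exp (ν * τ)) - s (τ - c)) atTop (𝓝 0) := by
    intro c
    obtain ⟨e, he, hbd⟩ := hunif 2
    have hidx : Tendsto (fun τ : ℝ => 2 * ⌊(τ - c) / 2⌋₊ + c) atTop atTop := by
      refine tendsto_atTop_mono (fun τ => (by omega : ⌊(τ - c) / 2⌋₊ ≤ _)) ?_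
      refine tendsto_nat_floor_atTop.comp (Tendsto.atTop_div_const (by norm_num) ?_)
      exact tendsto_atTop_add_const_right _ _ tendsto_id
    refine squeeze_zero_norm' ?_ (he.comp hidx)
    filter_upwards [eventually_ge_atTop (c : ℝ)] with τ hτ
    set i := ⌊(τ - c) / 2⌋₊ with hi
    have h1 : (i : ℝ) ≤ (τ - c) / 2 := Nat.floor_le (by linarith)
    have h2 : (τ - c) / 2 < i + 1 := Nat.lt_floor_add_one _
    have h3 := hbd (τ - c - i * 2) (by rw [abs_of_nonneg (by linarith)]; linarith) (2 * i + c)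
    rw [hper.sub_nat_mul_eq i] at h3
    simp only [hG, normalizedCount] at h3
    rw [pow_add, (even_two_mul i).neg_one_pow, one_mul] at h3
    push_cast at h3
    rw [show τ - c - (i : ℝ) * 2 + (2 * i + c) = τ by ring] at h3
    exact h3
  have hτtop : Tendsto (fun l : ℝ => Real.log l / ν) atTop atTop :=
    Tendsto.atTop_div_const hν0 Real.tendsto_log_atTop
  have hid : ∀ l : ℝ, 0 < l → Real.exp (-(κ * (Real.log l / ν))) = (l ^ (D / 2))⁻¹ ∧
      Real.exp (ν * (Real.log l / ν)) = l := by
    intro l hl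
    constructor
    · rw [Real.exp_neg, Real.rpow_def_of_pos hl, hκ]
      congr 2
      field_simp
    · rw [mul_div_cancel₀ _ hν0.ne', Real.exp_log hl]
  refine ⟨s, hcont, hs0, hper,
    ⟨fun l => Real.exp (-(κ * (Real.log l / ν))) *
      N ((-1) ^ 0 * Real.exp (ν * (Real.log l / ν))) - s (Real.log l / ν - (0 : ℕ)),
      (main 0).comp hτtop, fun l hl => ?_⟩,
    ⟨fun l => Real.exp (-(κ * (Real.log |l| / ν))) *
      N ((-1) ^ 1 * Real.exp (ν * (Real.log |l| / ν))) - s (Real.log |l| / ν - (1 : ℕ)),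
      (main 1).comp (hτtop.comp tendsto_abs_atBot_atTop), fun l hl => ?_⟩⟩
  · obtain ⟨h1, h2⟩ := hid l hl
    have h3 := (Real.rpow_pos_of_pos hl (D / 2)).ne'
    simp only [h1, h2]
    simp only [pow_zero, one_mul, Nat.cast_zero, sub_zero]
    field_simp
    ring
  · have hl' : 0 < |l| := abs_pos.2 hl.ne
    obtain ⟨h1, h2⟩ := hid |l| hl'
    have h3 := (Real.rpow_pos_of_pos hl' (D / 2)).ne'
    simp only [h1, h2]
    simp only [pow_one, neg_one_mul, Nat.cast_one]
    rw [show -|l| = l by rw [abs_of_neg hl, neg_neg]]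
    field_simp
    ring

end Counting

/-! ### The Sobolev space and the forms of the pencil -/

section Sobolev

/-- Lebesgue measure on `[0,1]`. -/
noncomputable abbrev unitMeasure : Measure ℝ := volume.restrict (Set.Icc 0 1)

lemma intervalIntegral_eq_unitMeasure {F : Type*} [NormedAddCommGroup F] [NormedSpace ℝ F]
    (f : ℝ → F) : ∫ x in (0 : ℝ)..1, f x = ∫ x, f x ∂unitMeasure := by
  rw [intervalIntegral.integral_of_le zero_le_one, integral_Icc_eq_integral_Ioc]

lemma intervalIntegrable_of_integrable {F : Type*} [NormedAddCommGroup F] {f : ℝ → F}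
    (hf : Integrable f unitMeasure) {x y : ℝ} (hx : x ∈ Set.Icc (0 : ℝ) 1)
    (hy : y ∈ Set.Icc (0 : ℝ) 1) : IntervalIntegrable f volume x y := by
  have h : IntegrableOn f (Set.Icc 0 1) volume := hf
  exact (h.mono_set (Set.uIcc_subset_Icc hx hy)).intervalIntegrable

lemma ae_unitMeasure_mem_Ioo : ∀ᵐ x ∂unitMeasure, x ∈ Set.Ioo (0 : ℝ) 1 := by
  rw [unitMeasure, ← restrict_Ioo_eq_restrict_Icc]
  exact ae_restrict_mem measurableSet_Ioo

lemma integrable_unit {F : Type*} [NormedAddCommGroup F] {f : ℝ → F} (hf : MemLp f 2 unitMeasure) :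
    Integrable f unitMeasure := hf.integrable (by norm_num)

lemma ae_deriv_eq {y g : ℝ → ℂ} (hg : MemLp g 2 unitMeasure)
    (hy : ∀ x ∈ Set.Icc (0 : ℝ) 1, y x = ∫ t in (0 : ℝ)..x, g t) :
    deriv y =ᵐ[unitMeasure] g := by
  have h1 := (intervalIntegrable_of_integrable (integrable_unit hg) (x := 0) (y := 1)
    (by simp) (by simp)).ae_hasDerivAt_integral
  filter_upwards [ae_restrict_of_ae h1, ae_unitMeasure_mem_Ioo] with x hx hx01
  rw [Set.uIcc_of_le zero_le_one] at hx
  have h2 := hx ⟨hx01.1.le, hx01.2.le⟩ 0 (by simp)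
  refine (h2.congr_of_eventuallyEq ?_).deriv
  filter_upwards [Ioo_mem_nhds hx01.1 hx01.2] with t ht
  exact hy t ⟨ht.1.le, ht.2.le⟩

lemma memLp_deriv (y : sobolevZero) : MemLp (deriv (y : ℝ → ℂ)) 2 unitMeasure := by
  obtain ⟨-, g, hg, hyg⟩ := y.2
  exact (memLp_congr_ae (ae_deriv_eq hg hyg)).2 hg

lemma apply_eq_integral_deriv (y : sobolevZero) {x : ℝ} (hx : x ∈ Set.Icc (0 : ℝ) 1) :
    (y : ℝ → ℂ) x = ∫ t in (0 : ℝ)..x, deriv (y : ℝ → ℂ) t := by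
  obtain ⟨-, g, hg, hyg⟩ := y.2
  rw [hyg x hx]
  refine intervalIntegral.integral_congr_ae ?_
  have h1 := (ae_restrict_iff' measurableSet_Icc).1 (ae_deriv_eq hg hyg)
  filter_upwards [h1] with t ht ht'
  rw [Set.uIoc_of_le hx.1] at ht'
  exact (ht ⟨ht'.1.le, ht'.2.trans hx.2⟩).symm

lemma apply_eq_zero (y : sobolevZero) {x : ℝ} (hx : x ∉ Set.Ioo (0 : ℝ) 1) :
    (y : ℝ → ℂ) x = 0 := y.2.1 x hx

/-- Every square integrable function of mean zero is the derivative of an element of the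
Sobolev space. -/
lemma exists_primitive {g : ℝ → ℂ} (hg : MemLp g 2 unitMeasure)
    (h0 : ∫ t, g t ∂unitMeasure = 0) :
    ∃ y : sobolevZero, deriv (y : ℝ → ℂ) =ᵐ[unitMeasure] g := by
  have h : ∀ x ∈ Set.Icc (0 : ℝ) 1,
      (Set.Ioo (0 : ℝ) 1).indicator (fun x => ∫ t in (0 : ℝ)..x, g t) x =
        ∫ t in (0 : ℝ)..x, g t := by
    intro x hx
    by_cases hx' : x ∈ Set.Ioo (0 : ℝ) 1
    · rw [Set.indicator_of_mem hx']
    · rw [Set.indicator_of_notMem hx']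
      rcases hx.1.eq_or_lt with rfl | h1
      · simp
      · obtain rfl : x = 1 := le_antisymm hx.2 (not_lt.1 fun h2 => hx' ⟨h1, h2⟩)
        rw [intervalIntegral_eq_unitMeasure, h0]
  exact ⟨⟨(Set.Ioo (0 : ℝ) 1).indicator fun x => ∫ t in (0 : ℝ)..x, g t,
    fun x hx => Set.indicator_of_notMem hx _, g, hg, h⟩, ae_deriv_eq hg h⟩

lemma continuousOn_primitive {F : Type*} [NormedAddCommGroup F] [NormedSpace ℝ F] {f : ℝ → F}
    (hf : Integrable f unitMeasure) :
    ContinuousOn (fun x => ∫ t in (0 : ℝ)..x, f t) (Set.Icc 0 1) := by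
  have h : IntegrableOn f (Set.uIcc 0 1) volume := by
    rw [Set.uIcc_of_le zero_le_one]
    exact hf
  have := intervalIntegral.continuousOn_primitive_interval (a := 0) (b := 1) h
  rwa [Set.uIcc_of_le zero_le_one] at this

lemma continuousOn_coe (y : sobolevZero) : ContinuousOn (y : ℝ → ℂ) (Set.Icc 0 1) :=
  (continuousOn_primitive (integrable_unit (memLp_deriv y))).congr
    fun _ hx => apply_eq_integral_deriv y hx

lemma aestronglyMeasurable_of_continuousOn {F : Type*} [NormedAddCommGroup F]
    [SecondCountableTopologyEither ℝ F] {f : ℝ → F}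
    (hf : ContinuousOn f (Set.Icc 0 1)) : AEStronglyMeasurable f unitMeasure :=
  hf.aestronglyMeasurable measurableSet_Icc

/-- The Cauchy-Schwarz inequality for real functions in `L₂[0,1]`. -/
lemma integral_mul_le_norm_toLp {f g : ℝ → ℝ} (hf : MemLp f 2 unitMeasure)
    (hg : MemLp g 2 unitMeasure) :
    ∫ x, f x * g x ∂unitMeasure ≤ ‖hf.toLp f‖ * ‖hg.toLp g‖ := by
  refine le_trans (le_of_eq ?_) (real_inner_le_norm (hf.toLp f) (hg.toLp g))
  rw [L2.inner_def]
  refine integral_congr_ae ?_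
  filter_upwards [hf.coeFn_toLp, hg.coeFn_toLp] with x h1 h2
  rw [h1, h2]
  simp [mul_comm]

lemma norm_toLp_norm {F : Type*} [NormedAddCommGroup F] {f : ℝ → F} (hf : MemLp f 2 unitMeasure) :
    ‖hf.norm.toLp (fun x => ‖f x‖)‖ = ‖hf.toLp f‖ := by
  rw [Lp.norm_toLp, Lp.norm_toLp, eLpNorm_norm]

lemma norm_primitive_le (f : ℝ → ℂ) {x : ℝ}
    (hx : x ∈ Set.Icc (0 : ℝ) 1) : ‖∫ t in (0 : ℝ)..x, f t‖ ≤ ∫ t in (0 : ℝ)..x, ‖f t‖ :=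
  intervalIntegral.norm_integral_le_integral_norm hx.1

lemma primitive_mono {f : ℝ → ℝ} (hf : Integrable f unitMeasure) (h0 : ∀ x, 0 ≤ f x) {x y : ℝ}
    (hx : x ∈ Set.Icc (0 : ℝ) 1) (hy : y ∈ Set.Icc (0 : ℝ) 1) (hxy : x ≤ y) :
    ∫ t in (0 : ℝ)..x, f t ≤ ∫ t in (0 : ℝ)..y, f t := by
  have h1 := intervalIntegral.integral_add_adjacent_intervals
    (intervalIntegrable_of_integrable hf (x := 0) (by simp) hx)
    (intervalIntegrable_of_integrable hf hx hy)
  have h2 := intervalIntegral.integral_nonneg (μ := volume) hxy (fun t _ => h0 t)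
  linarith

lemma norm_primitive_le_integral {f : ℝ → ℂ} (hf : Integrable f unitMeasure) {x : ℝ}
    (hx : x ∈ Set.Icc (0 : ℝ) 1) : ‖∫ t in (0 : ℝ)..x, f t‖ ≤ ∫ t, ‖f t‖ ∂unitMeasure := by
  refine (norm_primitive_le f hx).trans ?_
  rw [← intervalIntegral_eq_unitMeasure]
  exact primitive_mono hf.norm (fun _ => norm_nonneg _) hx (by simp) hx.2

/-- The space `L₂[0,1]` of complex functions. -/
abbrev L2Unit : Type := Lp ℂ 2 unitMeasure

/-- Differentiation as a linear map from the Sobolev space to `L₂[0,1]`. -/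
noncomputable def derivMap : sobolevZero →ₗ[ℂ] L2Unit where
  toFun y := (memLp_deriv y).toLp _
  map_add' y z := by
    rw [← MemLp.toLp_add, MemLp.toLp_eq_toLp_iff]
    refine ae_deriv_eq ((memLp_deriv y).add (memLp_deriv z)) fun x hx => ?_
    simp only [Submodule.coe_add, Pi.add_apply]
    rw [intervalIntegral.integral_add
        (intervalIntegrable_of_integrable (integrable_unit (memLp_deriv y)) (by simp) hx)
        (intervalIntegrable_of_integrable (integrable_unit (memLp_deriv z)) (by simp) hx),
      ← apply_eq_integral_deriv y hx, ← apply_eq_integral_deriv z hx]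
  map_smul' c y := by
    rw [RingHom.id_apply, ← MemLp.toLp_const_smul, MemLp.toLp_eq_toLp_iff]
    refine ae_deriv_eq ((memLp_deriv y).const_smul c) fun x hx => ?_
    simp only [Submodule.coe_smul, Pi.smul_apply]
    rw [intervalIntegral.integral_smul, ← apply_eq_integral_deriv y hx]

lemma coeFn_derivMap (y : sobolevZero) : derivMap y =ᵐ[unitMeasure] deriv (y : ℝ → ℂ) :=
  (memLp_deriv y).coeFn_toLp

lemma integral_norm_deriv_le (y : sobolevZero) :
    ∫ t, ‖deriv (y : ℝ → ℂ) t‖ ∂unitMeasure ≤ ‖derivMap y‖ := by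
  have h1 : MemLp (fun _ : ℝ => (1 : ℝ)) 2 unitMeasure := memLp_const 1
  have h2 := integral_mul_le_norm_toLp (memLp_deriv y).norm h1
  rw [norm_toLp_norm (memLp_deriv y)] at h2
  have h3 : ‖h1.toLp _‖ = 1 := by
    rw [Lp.norm_toLp, eLpNorm_const _ (by norm_num) (by simp)]
    simp
  rw [h3, mul_one] at h2
  simp only [mul_one] at h2
  exact h2

/-- The embedding of the Sobolev space into the bounded functions. -/
lemma norm_apply_le (y : sobolevZero) (x : ℝ) : ‖(y : ℝ → ℂ) x‖ ≤ ‖derivMap y‖ := by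
  by_cases hx : x ∈ Set.Ioo (0 : ℝ) 1
  · have hx' : x ∈ Set.Icc (0 : ℝ) 1 := ⟨hx.1.le, hx.2.le⟩
    rw [apply_eq_integral_deriv y hx']
    exact (norm_primitive_le_integral (integrable_unit (memLp_deriv y)) hx').trans
      (integral_norm_deriv_le y)
  · rw [apply_eq_zero y hx, norm_zero]
    exact norm_nonneg _

variable {P : ℝ → ℝ} (hP : MemLp P 2 unitMeasure)

include hP in
lemma memLp_ofReal : MemLp (fun x => (P x : ℂ)) 2 unitMeasure := hP.ofReal

include hP in
lemma memLp_mul_of_bounded {f : ℝ → ℂ} (hf : AEStronglyMeasurable f unitMeasure) {c : ℝ}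
    (hc : ∀ᵐ x ∂unitMeasure, ‖f x‖ ≤ c) : MemLp (fun x => (P x : ℂ) * f x) 2 unitMeasure :=
  (memLp_top_of_bound hf c hc).mul (memLp_ofReal hP)

include hP in
lemma memLp_mul_coe (y : sobolevZero) :
    MemLp (fun x => (P x : ℂ) * (y : ℝ → ℂ) x) 2 unitMeasure :=
  memLp_mul_of_bounded hP (aestronglyMeasurable_of_continuousOn (continuousOn_coe y))
    (Eventually.of_forall (norm_apply_le y))

/-- Multiplication by `P` as a linear map from the Sobolev space to `L₂[0,1]`. -/
noncomputable def mulMap : sobolevZero →ₗ[ℂ] L2Unit where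
  toFun y := (memLp_mul_coe hP y).toLp _
  map_add' y z := by
    rw [← MemLp.toLp_add, MemLp.toLp_eq_toLp_iff]
    refine Eventually.of_forall fun x => ?_
    simp [mul_add]
  map_smul' c y := by
    rw [RingHom.id_apply, ← MemLp.toLp_const_smul, MemLp.toLp_eq_toLp_iff]
    refine Eventually.of_forall fun x => ?_
    simp only [Submodule.coe_smul, Pi.smul_apply, smul_eq_mul]
    ring

lemma coeFn_mulMap (y : sobolevZero) :
    mulMap hP y =ᵐ[unitMeasure] fun x => (P x : ℂ) * (y : ℝ → ℂ) x :=
  (memLp_mul_coe hP y).coeFn_toLp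

lemma norm_mulMap_le (y : sobolevZero) : ‖mulMap hP y‖ ≤ ‖hP.toLp P‖ * ‖derivMap y‖ := by
  rw [mul_comm]
  refine Lp.norm_le_mul_norm_of_ae_le_mul ?_
  filter_upwards [coeFn_mulMap hP y, hP.coeFn_toLp] with x h1 h2
  rw [h1, h2, norm_mul, Complex.norm_real, mul_comm]
  exact mul_le_mul_of_nonneg_right (norm_apply_le y x) (norm_nonneg _)

/-- The sesquilinear form `(y, z) ↦ ⟨A y, A' z⟩` of a pair of linear maps to an inner product
space. -/
noncomputable def innerForm {E H : Type*} [AddCommGroup E] [Module ℂ E] [NormedAddCommGroup H]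
    [InnerProductSpace ℂ H] (A A' : E →ₗ[ℂ] H) : E →ₗ[ℂ] E →ₗ⋆[ℂ] ℂ :=
  LinearMap.mk₂'ₛₗ (RingHom.id ℂ) (starRingEnd ℂ) (fun y z => inner ℂ (A' z) (A y))
    (fun y y' z => by simp) (fun c y z => by simp)
    (fun y z z' => by simp) (fun c y z => by simp [mul_comm])

lemma innerForm_apply {E H : Type*} [AddCommGroup E] [Module ℂ E] [NormedAddCommGroup H]
    [InnerProductSpace ℂ H] (A A' : E →ₗ[ℂ] H) (y z : E) :
    innerForm A A' y z = inner ℂ (A' z) (A y) := rfl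

/-- The form `∫ y' conj z'`. -/
noncomputable def energyForm : sobolevZero →ₗ[ℂ] sobolevZero →ₗ⋆[ℂ] ℂ :=
  innerForm derivMap derivMap

/-- The form `∫ P (y' conj z + y conj z')`. -/
noncomputable def weightForm : sobolevZero →ₗ[ℂ] sobolevZero →ₗ⋆[ℂ] ℂ :=
  innerForm derivMap (mulMap hP) + innerForm (mulMap hP) derivMap

lemma weightForm_apply (y z : sobolevZero) : weightForm hP y z =
    inner ℂ (mulMap hP z) (derivMap y) + inner ℂ (derivMap z) (mulMap hP y) := rfl

lemma isHermForm_energyForm : IsHermForm energyForm := fun y z =>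
  (inner_conj_symm (derivMap y) (derivMap z)).symm

lemma isHermForm_weightForm : IsHermForm (weightForm hP) := fun y z => by
  rw [weightForm_apply, weightForm_apply, star_add, add_comm]
  congr 1
  · exact (inner_conj_symm _ _).symm
  · exact (inner_conj_symm _ _).symm

lemma re_energyForm_self (y : sobolevZero) : (energyForm y y).re = ‖derivMap y‖ ^ 2 :=
  inner_self_eq_norm_sq (𝕜 := ℂ) (derivMap y)

lemma formNorm_energyForm (y : sobolevZero) : formNorm energyForm y = ‖derivMap y‖ := by
  rw [formNorm, re_energyForm_self, Real.sqrt_sq (norm_nonneg _)]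

lemma norm_energyForm_le (y z : sobolevZero) :
    ‖energyForm y z‖ ≤ formNorm energyForm y * formNorm energyForm z := by
  rw [formNorm_energyForm, formNorm_energyForm, mul_comm]
  exact norm_inner_le_norm (𝕜 := ℂ) (derivMap z) (derivMap y)

lemma norm_weightForm_le (y z : sobolevZero) : ‖weightForm hP y z‖ ≤
    2 * ‖hP.toLp P‖ * (formNorm energyForm y * formNorm energyForm z) := by
  rw [formNorm_energyForm, formNorm_energyForm, weightForm_apply]
  have h1 : ‖(inner ℂ (mulMap hP z) (derivMap y) : ℂ)‖ ≤
      (‖hP.toLp P‖ * ‖derivMap z‖) * ‖derivMap y‖ :=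
    (norm_inner_le_norm _ _).trans
      (mul_le_mul_of_nonneg_right (norm_mulMap_le hP z) (norm_nonneg _))
  have h2 : ‖(inner ℂ (derivMap z) (mulMap hP y) : ℂ)‖ ≤
      ‖derivMap z‖ * (‖hP.toLp P‖ * ‖derivMap y‖) :=
    (norm_inner_le_norm _ _).trans
      (mul_le_mul_of_nonneg_left (norm_mulMap_le hP y) (norm_nonneg _))
  have h3 := norm_add_le (inner ℂ (mulMap hP z) (derivMap y) : ℂ)
    (inner ℂ (derivMap z) (mulMap hP y))
  linarith

include hP in
lemma integrable_weight (y z : sobolevZero) :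
    Integrable (fun x => (P x : ℂ) * (deriv (y : ℝ → ℂ) x * star ((z : ℝ → ℂ) x))) unitMeasure := by
  have := (memLp_deriv y).integrable_mul (memLp_mul_coe hP z).star
  refine this.congr (Eventually.of_forall fun x => ?_)
  simp
  ring

lemma pencil_eq_form (l : ℝ) (y z : sobolevZero) :
    pencil P l y z = (energyForm + (l : ℂ) • weightForm hP) y z := by
  have h1 : inner ℂ (derivMap z) (derivMap y) =
      ∫ x, deriv (y : ℝ → ℂ) x * star (deriv (z : ℝ → ℂ) x) ∂unitMeasure := by
    rw [L2.inner_def]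
    refine integral_congr_ae ?_
    filter_upwards [coeFn_derivMap y, coeFn_derivMap z] with x h1 h2
    rw [h1, h2]
    simp
  have h2 : inner ℂ (mulMap hP z) (derivMap y) =
      ∫ x, (P x : ℂ) * (deriv (y : ℝ → ℂ) x * star ((z : ℝ → ℂ) x)) ∂unitMeasure := by
    rw [L2.inner_def]
    refine integral_congr_ae ?_
    filter_upwards [coeFn_derivMap y, coeFn_mulMap hP z] with x h1 h2
    rw [h1, h2]
    simp
    ring
  have h3 : inner ℂ (derivMap z) (mulMap hP y) =
      ∫ x, (P x : ℂ) * ((y : ℝ → ℂ) x * star (deriv (z : ℝ → ℂ) x)) ∂unitMeasure := by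
    rw [L2.inner_def]
    refine integral_congr_ae ?_
    filter_upwards [coeFn_derivMap z, coeFn_mulMap hP y] with x h1 h2
    rw [h1, h2]
    simp
    ring
  have i1 : Integrable (fun x => deriv (y : ℝ → ℂ) x * star (deriv (z : ℝ → ℂ) x)) unitMeasure :=
    (memLp_deriv y).integrable_mul (memLp_deriv z).star
  have i2 := integrable_weight hP y z
  have i3 : Integrable (fun x => (P x : ℂ) * ((y : ℝ → ℂ) x * star (deriv (z : ℝ → ℂ) x)))
      unitMeasure := by
    refine ((memLp_mul_coe hP y).integrable_mul (memLp_deriv z).star).congr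
      (Eventually.of_forall fun x => ?_)
    simp
    ring
  simp only [LinearMap.add_apply, LinearMap.smul_apply, weightForm_apply]
  rw [energyForm, innerForm_apply, h1, h2, h3, pencil, intervalIntegral_eq_unitMeasure, smul_eq_mul,
    ← integral_add i2 i3, ← integral_const_mul]
  refine Eq.trans ?_ (integral_add i1 ((i2.add i3).const_mul _))
  refine integral_congr_ae (Eventually.of_forall fun x => ?_)
  ring

lemma negIndex_eq (l : ℝ) : negIndex P l = negInd (energyForm + (l : ℂ) • weightForm hP) := by
  simp only [negIndex, negInd, pencil_eq_form hP]

/-- The index vanishes for small parameters. -/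
lemma negIndex_eq_zero {l : ℝ} (hl : |l| * (2 * ‖hP.toLp P‖) ≤ 1) : negIndex P l = 0 := by
  rw [negIndex_eq hP]
  have := negInd_le_finrank (energyForm + (l : ℂ) • weightForm hP)
    (0 : sobolevZero →ₗ[ℂ] (Fin 0 → ℂ)) (fun y _ => by
      rw [re_add_smul_apply]
      have h1 := (Complex.abs_re_le_norm _).trans (norm_weightForm_le hP y y)
      have h2 : formNorm energyForm y * formNorm energyForm y = (energyForm y y).re := by
        rw [formNorm_energyForm, re_energyForm_self, sq]
      rw [h2] at h1
      have h3 : 0 ≤ (energyForm y y).re := by rw [re_energyForm_self]; positivity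
      have h4 : |l * (weightForm hP y y).re| ≤ |l| * (2 * ‖hP.toLp P‖ * (energyForm y y).re) := by
        rw [abs_mul]
        exact mul_le_mul_of_nonneg_left h1 (abs_nonneg _)
      have h5 := (abs_le.1 h4).1
      nlinarith)
  simpa using this

end Sobolev

/-! ### Integration by parts and Gronwall's inequality -/

section Parts

lemma integral_parts_real {f g : ℝ → ℝ} (hf : Integrable f unitMeasure)
    (hg : Integrable g unitMeasure) :
    ∫ x, (f x * (∫ t in (0 : ℝ)..x, g t) + (∫ t in (0 : ℝ)..x, f t) * g x) ∂unitMeasure =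
      (∫ x, f x ∂unitMeasure) * ∫ x, g x ∂unitMeasure := by
  have hf' := intervalIntegrable_of_integrable hf (x := 0) (y := 1) (by simp) (by simp)
  have hg' := intervalIntegrable_of_integrable hg (x := 0) (y := 1) (by simp) (by simp)
  have h := AbsolutelyContinuousOnInterval.integral_deriv_mul_eq_sub
    (hf'.absolutelyContinuousOnInterval_intervalIntegral (c := 0) (by simp))
    (hg'.absolutelyContinuousOnInterval_intervalIntegral (c := 0) (by simp))
  rw [intervalIntegral.integral_same, zero_mul, sub_zero] at h
  rw [← intervalIntegral_eq_unitMeasure f, ← intervalIntegral_eq_unitMeasure g, ← h,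
    ← intervalIntegral_eq_unitMeasure]
  refine intervalIntegral.integral_congr_ae ?_
  filter_upwards [hf'.ae_hasDerivAt_integral, hg'.ae_hasDerivAt_integral] with x h1 h2 hx
  have hx' : x ∈ Set.uIcc (0 : ℝ) 1 := Set.uIoc_subset_uIcc hx
  rw [(h1 hx' 0 (by simp)).deriv, (h2 hx' 0 (by simp)).deriv]

lemma integrable_mul_continuousOn {f g : ℝ → ℂ} (hf : Integrable f unitMeasure)
    (hg : ContinuousOn g (Set.Icc 0 1)) : Integrable (fun x => f x * g x) unitMeasure :=
  IntegrableOn.mul_continuousOn hf hg isCompact_Icc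

/-- Integration by parts for primitives of integrable complex functions. -/
lemma integral_parts {f g : ℝ → ℂ} (hf : Integrable f unitMeasure)
    (hg : Integrable g unitMeasure) :
    ∫ x, (f x * (∫ t in (0 : ℝ)..x, g t) + (∫ t in (0 : ℝ)..x, f t) * g x) ∂unitMeasure =
      (∫ x, f x ∂unitMeasure) * ∫ x, g x ∂unitMeasure := by
  have hcf := continuousOn_primitive hf
  have hcg := continuousOn_primitive hg
  have hint : Integrable (fun x => f x * (∫ t in (0 : ℝ)..x, g t) +
      (∫ t in (0 : ℝ)..x, f t) * g x) unitMeasure := by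
    refine (integrable_mul_continuousOn hf hcg).add ?_
    simpa only [mul_comm] using integrable_mul_continuousOn hg hcf
  have hre : ∀ {f : ℝ → ℂ}, Integrable f unitMeasure → ∀ x ∈ Set.Icc (0 : ℝ) 1,
      (∫ t in (0 : ℝ)..x, f t).re = ∫ t in (0 : ℝ)..x, (f t).re := fun {f} hf x hx =>
    (Complex.reCLM.intervalIntegral_comp_comm
      (intervalIntegrable_of_integrable hf (x := 0) (by simp) hx)).symm
  have him : ∀ {f : ℝ → ℂ}, Integrable f unitMeasure → ∀ x ∈ Set.Icc (0 : ℝ) 1,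
      (∫ t in (0 : ℝ)..x, f t).im = ∫ t in (0 : ℝ)..x, (f t).im := fun {f} hf x hx =>
    (Complex.imCLM.intervalIntegral_comp_comm
      (intervalIntegrable_of_integrable hf (x := 0) (by simp) hx)).symm
  have hre1 : ∀ {f : ℝ → ℂ}, Integrable f unitMeasure →
      (∫ t, f t ∂unitMeasure).re = ∫ t, (f t).re ∂unitMeasure := fun {f} hf =>
    (Complex.reCLM.integral_comp_comm hf).symm
  have him1 : ∀ {f : ℝ → ℂ}, Integrable f unitMeasure →
      (∫ t, f t ∂unitMeasure).im = ∫ t, (f t).im ∂unitMeasure := fun {f} hf =>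
    (Complex.imCLM.integral_comp_comm hf).symm
  have hint' : ∀ {f g : ℝ → ℝ}, Integrable f unitMeasure → Integrable g unitMeasure →
      Integrable (fun x => f x * (∫ t in (0 : ℝ)..x, g t) + (∫ t in (0 : ℝ)..x, f t) * g x)
        unitMeasure := fun {f g} hf hg =>
    Integrable.add (IntegrableOn.mul_continuousOn hf (continuousOn_primitive hg) isCompact_Icc)
      (IntegrableOn.continuousOn_mul (continuousOn_primitive hf) hg isCompact_Icc)
  have hmem : ∀ᵐ x ∂unitMeasure, x ∈ Set.Icc (0 : ℝ) 1 := ae_restrict_mem measurableSet_Icc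
  have fr : Integrable (fun t => (f t).re) unitMeasure := hf.re
  have fi : Integrable (fun t => (f t).im) unitMeasure := hf.im
  have gr : Integrable (fun t => (g t).re) unitMeasure := hg.re
  have gi : Integrable (fun t => (g t).im) unitMeasure := hg.im
  apply Complex.ext
  · rw [hre1 hint, Complex.mul_re, hre1 hf, hre1 hg, him1 hf, him1 hg,
      ← integral_parts_real fr gr, ← integral_parts_real fi gi,
      ← integral_sub (hint' fr gr) (hint' fi gi)]
    refine integral_congr_ae ?_
    filter_upwards [hmem] with x hx
    simp only [Complex.add_re, Complex.mul_re, hre hf x hx, hre hg x hx, him hf x hx, him hg x hx]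
    ring
  · rw [him1 hint, Complex.mul_im, hre1 hf, hre1 hg, him1 hf, him1 hg,
      ← integral_parts_real fr gi, ← integral_parts_real fi gr,
      ← integral_add (hint' fr gi) (hint' fi gr)]
    refine integral_congr_ae ?_
    filter_upwards [hmem] with x hx
    simp only [Complex.add_im, Complex.mul_im, hre hf x hx, hre hg x hx, him hf x hx, him hg x hx]
    ring

lemma star_apply_eq_integral (y : sobolevZero) {x : ℝ} (hx : x ∈ Set.Icc (0 : ℝ) 1) :
    star ((y : ℝ → ℂ) x) = ∫ t in (0 : ℝ)..x, star (deriv (y : ℝ → ℂ) t) := by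
  rw [apply_eq_integral_deriv y hx]
  exact (Complex.conjCLE.toContinuousLinearMap.intervalIntegral_comp_comm
    (intervalIntegrable_of_integrable (integrable_unit (memLp_deriv y)) (x := 0) (by simp) hx)).symm

lemma integrable_star_deriv (y : sobolevZero) :
    Integrable (fun x => star (deriv (y : ℝ → ℂ) x)) unitMeasure :=
  integrable_unit (memLp_deriv y).star

lemma integral_star_deriv_eq_zero (y : sobolevZero) :
    ∫ x, star (deriv (y : ℝ → ℂ) x) ∂unitMeasure = 0 := by
  rw [← intervalIntegral_eq_unitMeasure, ← star_apply_eq_integral y (by simp),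
    apply_eq_zero y (by simp), star_zero]

/-- Integration by parts against an element of the Sobolev space. -/
lemma integral_mul_star_eq (f : ℝ → ℂ) (hf : Integrable f unitMeasure) (z : sobolevZero) :
    ∫ x, f x * star ((z : ℝ → ℂ) x) ∂unitMeasure =
      -∫ x, (∫ t in (0 : ℝ)..x, f t) * star (deriv (z : ℝ → ℂ) x) ∂unitMeasure := by
  have hz := integrable_star_deriv z
  have h := integral_parts hf hz
  rw [integral_star_deriv_eq_zero, mul_zero, integral_add
    (integrable_mul_continuousOn hf (continuousOn_primitive hz))
    (by simpa only [mul_comm] using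
      integrable_mul_continuousOn hz (continuousOn_primitive hf))] at h
  rw [← eq_neg_iff_add_eq_zero] at h
  rw [← h]
  refine integral_congr_ae ?_
  filter_upwards [ae_restrict_mem measurableSet_Icc] with x hx
  rw [star_apply_eq_integral z hx]

end Parts

section Gronwall

/-- An integral form of Gronwall's inequality for an integrable coefficient. -/
lemma gronwall_integral {φ G : ℝ → ℝ} (hφ : Integrable φ unitMeasure) (hφ0 : ∀ x, 0 ≤ φ x)
    (hG : ContinuousOn G (Set.Icc 0 1)) {c : ℝ} (hc : 0 ≤ c)
    (h : ∀ x ∈ Set.Icc (0 : ℝ) 1, G x ≤ c + ∫ t in (0 : ℝ)..x, φ t * G t)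
    {x : ℝ} (hx : x ∈ Set.Icc (0 : ℝ) 1) :
    G x ≤ 2 * c * Real.exp (2 * ∫ t, φ t ∂unitMeasure) := by
  set Φ : ℝ → ℝ := fun x => ∫ t in (0 : ℝ)..x, φ t with hΦ
  have hΦc : ContinuousOn Φ (Set.Icc 0 1) := continuousOn_primitive hφ
  have hΦmono : ∀ x ∈ Set.Icc (0 : ℝ) 1, ∀ y ∈ Set.Icc (0 : ℝ) 1, x ≤ y → Φ x ≤ Φ y :=
    fun x hx y hy hxy => primitive_mono hφ hφ0 hx hy hxy
  have hφe : ∀ x ∈ Set.Icc (0 : ℝ) 1,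
      IntervalIntegrable (fun t => φ t * Real.exp (2 * Φ t)) volume 0 x := by
    intro x hx
    refine intervalIntegrable_of_integrable (IntegrableOn.mul_continuousOn hφ ?_ isCompact_Icc)
      (by simp) hx
    exact Real.continuous_exp.comp_continuousOn (hΦc.const_smul (2 : ℝ))
  have hexp : ∀ x ∈ Set.Icc (0 : ℝ) 1,
      ∫ t in (0 : ℝ)..x, φ t * Real.exp (2 * Φ t) ≤ (Real.exp (2 * Φ x) - 1) / 2 := by
    intro x hx
    have hsub : Set.uIcc 0 x ⊆ Set.Icc (0 : ℝ) 1 := by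
      rw [Set.uIcc_of_le hx.1]; exact Set.Icc_subset_Icc_right hx.2
    have hmono : MonotoneOn (fun t => Real.exp (2 * Φ t) / 2) (Set.uIcc 0 x) := by
      intro s hs t ht hst
      have := hΦmono s (hsub hs) t (hsub ht) hst
      have := Real.exp_le_exp.2 (show 2 * Φ s ≤ 2 * Φ t by linarith)
      simp only
      linarith
    have h1 := hmono.intervalIntegral_deriv_mem_uIcc
    have h2 : ∫ t in (0 : ℝ)..x, φ t * Real.exp (2 * Φ t) =
        ∫ t in (0 : ℝ)..x, deriv (fun t => Real.exp (2 * Φ t) / 2) t := by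
      refine intervalIntegral.integral_congr_ae ?_
      filter_upwards [(intervalIntegrable_of_integrable hφ (x := 0) (y := 1) (by simp)
        (by simp)).ae_hasDerivAt_integral] with t ht htx
      have ht' : t ∈ Set.uIcc (0 : ℝ) 1 := by
        rw [Set.uIcc_of_le zero_le_one]
        exact hsub (Set.uIoc_subset_uIcc htx)
      have h3 : HasDerivAt Φ (φ t) t := ht ht' 0 (by simp)
      rw [((h3.const_mul 2).exp.div_const 2).deriv]
      ring
    have h0 : Real.exp (2 * Φ 0) = 1 := by simp [hΦ]
    have h4 : 0 ≤ Real.exp (2 * Φ x) / 2 - Real.exp (2 * Φ 0) / 2 := by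
      have := hmono (by simp : (0 : ℝ) ∈ Set.uIcc 0 x) (by simp : x ∈ Set.uIcc 0 x) hx.1
      simp only at this
      linarith
    rw [Set.uIcc_of_le h4] at h1
    rw [h2]
    refine h1.2.trans (le_of_eq ?_)
    rw [h0]
    ring
  -- at a maximum of `G e^{-2 Φ}` the inequality bounds the maximal value by `2 c`
  obtain ⟨x₀, hx₀, hmax⟩ := isCompact_Icc.exists_isMaxOn (Set.nonempty_Icc.2 zero_le_one)
    (hG.mul (Real.continuous_exp.comp_continuousOn (hΦc.const_smul (-2 : ℝ))))
  set M := G x₀ * Real.exp (-2 * Φ x₀) with hM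
  have hGM : ∀ t ∈ Set.Icc (0 : ℝ) 1, G t ≤ M * Real.exp (2 * Φ t) := by
    intro t ht
    have h1 : G t * Real.exp (-2 * Φ t) ≤ M := hmax ht
    have h2 : Real.exp (-2 * Φ t) * Real.exp (2 * Φ t) = 1 := by
      rw [← Real.exp_add]; simp
    calc G t = G t * Real.exp (-2 * Φ t) * Real.exp (2 * Φ t) := by rw [mul_assoc, h2, mul_one]
      _ ≤ _ := mul_le_mul_of_nonneg_right h1 (Real.exp_pos _).le
  have hΦ0 : ∀ t ∈ Set.Icc (0 : ℝ) 1, 0 ≤ Φ t := fun t ht => by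
    have := hΦmono 0 (by simp) t ht ht.1
    simpa [hΦ] using this
  have hM2 : M ≤ 2 * c := by
    by_contra! hcon
    have hM0 : 0 < M := by linarith
    have h1 : ∫ t in (0 : ℝ)..x₀, φ t * G t ≤
        ∫ t in (0 : ℝ)..x₀, M * (φ t * Real.exp (2 * Φ t)) := by
      refine intervalIntegral.integral_mono_on hx₀.1 ?_ ((hφe x₀ hx₀).const_mul M) fun t ht => ?_
      · exact intervalIntegrable_of_integrable (IntegrableOn.mul_continuousOn hφ hG isCompact_Icc)
          (by simp) hx₀
      · have := mul_le_mul_of_nonneg_left (hGM t ⟨ht.1, ht.2.trans hx₀.2⟩) (hφ0 t)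
        linarith
    rw [intervalIntegral.integral_const_mul] at h1
    have h2 := mul_le_mul_of_nonneg_left (hexp x₀ hx₀) hM0.le
    have h3 : G x₀ = M * Real.exp (2 * Φ x₀) := by
      rw [hM, mul_assoc, ← Real.exp_add]; simp
    have h4 := h x₀ hx₀
    have h5 : 1 ≤ Real.exp (2 * Φ x₀) := Real.one_le_exp (by linarith [hΦ0 x₀ hx₀])
    nlinarith
  have h1 : Real.exp (2 * Φ x) ≤ Real.exp (2 * ∫ t, φ t ∂unitMeasure) := by
    rw [← intervalIntegral_eq_unitMeasure]
    exact Real.exp_le_exp.2 (by linarith [hΦmono x hx 1 (by simp) hx.2])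
  calc G x ≤ M * Real.exp (2 * Φ x) := hGM x hx
    _ ≤ 2 * c * Real.exp (2 * Φ x) := mul_le_mul_of_nonneg_right hM2 (Real.exp_pos _).le
    _ ≤ _ := mul_le_mul_of_nonneg_left h1 (by linarith)

end Gronwall

/-! ### Unique continuation and the jumps of the index -/

section UniqueContinuation

variable {P : ℝ → ℝ} (hP : MemLp P 2 unitMeasure)

include hP in
lemma integrable_mul_deriv (y : sobolevZero) :
    Integrable (fun x => (P x : ℂ) * deriv (y : ℝ → ℂ) x) unitMeasure :=
  (memLp_ofReal hP).integrable_mul (memLp_deriv y)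

lemma memLp_primitive {f : ℝ → ℂ} (hf : Integrable f unitMeasure) :
    MemLp (fun x => ∫ t in (0 : ℝ)..x, f t) 2 unitMeasure := by
  refine MemLp.of_bound (aestronglyMeasurable_of_continuousOn (continuousOn_primitive hf))
    (∫ t, ‖f t‖ ∂unitMeasure) ?_
  filter_upwards [ae_restrict_mem measurableSet_Icc] with x hx
  exact norm_primitive_le_integral hf hx

/-- The map sending `y` to the primitive of `P y'` that vanishes at zero. -/
noncomputable def primMap : sobolevZero →ₗ[ℂ] L2Unit where
  toFun y := (memLp_primitive (integrable_mul_deriv hP y)).toLp _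
  map_add' y z := by
    rw [← MemLp.toLp_add, MemLp.toLp_eq_toLp_iff]
    filter_upwards [ae_restrict_mem measurableSet_Icc] with x hx
    rw [Pi.add_apply, ← intervalIntegral.integral_add
      (intervalIntegrable_of_integrable (integrable_mul_deriv hP y) (by simp) hx)
      (intervalIntegrable_of_integrable (integrable_mul_deriv hP z) (by simp) hx)]
    refine intervalIntegral.integral_congr_ae ?_
    have h : deriv ((y + z : sobolevZero) : ℝ → ℂ) =ᵐ[unitMeasure]
        deriv (y : ℝ → ℂ) + deriv (z : ℝ → ℂ) := by
      have h1 := Lp.coeFn_add (derivMap y) (derivMap z)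
      rw [← map_add] at h1
      filter_upwards [h1, coeFn_derivMap y, coeFn_derivMap z, coeFn_derivMap (y + z)]
        with t h1 h2 h3 h4
      rw [← h4, h1, Pi.add_apply, h2, h3, Pi.add_apply]
    filter_upwards [(ae_restrict_iff' measurableSet_Icc).1 h] with t ht htx
    rw [Set.uIoc_of_le hx.1] at htx
    rw [ht ⟨htx.1.le, htx.2.trans hx.2⟩, Pi.add_apply, mul_add]
  map_smul' c y := by
    rw [RingHom.id_apply, ← MemLp.toLp_const_smul, MemLp.toLp_eq_toLp_iff]
    filter_upwards [ae_restrict_mem measurableSet_Icc] with x hx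
    rw [Pi.smul_apply, ← intervalIntegral.integral_smul]
    refine intervalIntegral.integral_congr_ae ?_
    have h : deriv ((c • y : sobolevZero) : ℝ → ℂ) =ᵐ[unitMeasure] c • deriv (y : ℝ → ℂ) := by
      have h1 := Lp.coeFn_smul c (derivMap y)
      rw [← map_smul] at h1
      filter_upwards [h1, coeFn_derivMap y, coeFn_derivMap (c • y)] with t h1 h2 h4
      rw [← h4, h1, Pi.smul_apply, h2, Pi.smul_apply]
    filter_upwards [(ae_restrict_iff' measurableSet_Icc).1 h] with t ht htx
    rw [Set.uIoc_of_le hx.1] at htx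
    rw [ht ⟨htx.1.le, htx.2.trans hx.2⟩, Pi.smul_apply]
    simp only [smul_eq_mul]
    ring

lemma coeFn_primMap (y : sobolevZero) : primMap hP y =ᵐ[unitMeasure]
    fun x => ∫ t in (0 : ℝ)..x, (P t : ℂ) * deriv (y : ℝ → ℂ) t :=
  (memLp_primitive (integrable_mul_deriv hP y)).coeFn_toLp

lemma inner_mulMap_derivMap (y z : sobolevZero) :
    inner ℂ (mulMap hP z) (derivMap y) = -(inner ℂ (derivMap z) (primMap hP y) : ℂ) := by
  have h1 : inner ℂ (mulMap hP z) (derivMap y) =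
      ∫ x, ((P x : ℂ) * deriv (y : ℝ → ℂ) x) * star ((z : ℝ → ℂ) x) ∂unitMeasure := by
    rw [L2.inner_def]
    refine integral_congr_ae ?_
    filter_upwards [coeFn_derivMap y, coeFn_mulMap hP z] with x h1 h2
    rw [h1, h2]
    simp
    ring
  rw [h1, integral_mul_star_eq _ (integrable_mul_deriv hP y), L2.inner_def]
  congr 1
  refine integral_congr_ae ?_
  filter_upwards [coeFn_derivMap z, coeFn_primMap hP y] with x h1 h2
  rw [h1, h2]
  simp

/-- The quasi-derivative `y' + l P y - l ∫ P y'`; it is constant when `y` lies in the kernel of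
the pencil. -/
noncomputable def quasiDeriv (l : ℝ) : sobolevZero →ₗ[ℂ] L2Unit :=
  derivMap + (l : ℂ) • mulMap hP - (l : ℂ) • primMap hP

lemma form_eq_inner_quasiDeriv (l : ℝ) (y z : sobolevZero) :
    (energyForm + (l : ℂ) • weightForm hP) y z = inner ℂ (derivMap z) (quasiDeriv hP l y) := by
  simp only [LinearMap.add_apply, LinearMap.smul_apply, weightForm_apply, quasiDeriv,
    LinearMap.sub_apply, inner_sub_right, inner_add_right, inner_smul_right, smul_eq_mul,
    inner_mulMap_derivMap, energyForm, innerForm_apply]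
  ring

/-- Quantitative unique continuation: since `y(0) = 0`, the quasi-derivative controls `y'`. -/
lemma exists_norm_derivMap_le (l : ℝ) :
    ∃ C, 0 ≤ C ∧ ∀ y : sobolevZero, ‖derivMap y‖ ≤ C * ‖quasiDeriv hP l y‖ := by
  have hp : MemLp (fun x => 1 + ‖P x‖) 2 unitMeasure :=
    (memLp_const (1 : ℝ)).add hP.norm
  set p : ℝ → ℝ := fun x => 1 + ‖P x‖ with hpdef
  have hp0 : ∀ x, 0 ≤ p x := fun x => by simp only [hpdef]; positivity
  set A := ‖hp.toLp p‖ with hA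
  set φ : ℝ → ℝ := fun x => |l| * p x ^ 2 with hφdef
  have hφ : Integrable φ unitMeasure := hp.integrable_sq.const_mul _
  set E := Real.exp (2 * ∫ t, φ t ∂unitMeasure) with hE
  refine ⟨1 + |l| * (2 * A * E) * A, by positivity, fun y => ?_⟩
  set h := quasiDeriv hP l y with hh
  have hhL : MemLp h 2 unitMeasure := Lp.memLp h
  have hph : Integrable (fun x => p x * ‖h x‖) unitMeasure := hp.integrable_mul hhL.norm
  have hpy : Integrable (fun x => p x * ‖deriv (y : ℝ → ℂ) x‖) unitMeasure :=
    hp.integrable_mul (memLp_deriv y).norm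
  set G : ℝ → ℝ := fun x => ∫ t in (0 : ℝ)..x, p t * ‖deriv (y : ℝ → ℂ) t‖ with hG
  have hGc : ContinuousOn G (Set.Icc 0 1) := continuousOn_primitive hpy
  have hyG : ∀ x ∈ Set.Icc (0 : ℝ) 1, ‖(y : ℝ → ℂ) x‖ ≤ G x := by
    intro x hx
    rw [apply_eq_integral_deriv y hx]
    refine (norm_primitive_le _ hx).trans ?_
    refine intervalIntegral.integral_mono_on hx.1
      (intervalIntegrable_of_integrable (integrable_unit (memLp_deriv y)).norm (by simp) hx)
      (intervalIntegrable_of_integrable hpy (by simp) hx) fun t _ => ?_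
    simp only [hpdef]
    nlinarith [norm_nonneg (P t), norm_nonneg (deriv (y : ℝ → ℂ) t)]
  have hKG : ∀ x ∈ Set.Icc (0 : ℝ) 1,
      ‖∫ t in (0 : ℝ)..x, (P t : ℂ) * deriv (y : ℝ → ℂ) t‖ ≤ G x := by
    intro x hx
    refine (norm_primitive_le _ hx).trans ?_
    refine intervalIntegral.integral_mono_on hx.1
      (intervalIntegrable_of_integrable (integrable_mul_deriv hP y).norm (by simp) hx)
      (intervalIntegrable_of_integrable hpy (by simp) hx) fun t _ => ?_
    simp only [hpdef, norm_mul, Complex.norm_real]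
    nlinarith [norm_nonneg (deriv (y : ℝ → ℂ) t)]
  have hae : ∀ᵐ x ∂unitMeasure, ‖deriv (y : ℝ → ℂ) x‖ ≤ ‖h x‖ + |l| * (p x * G x) := by
    have e1 := Lp.coeFn_sub (derivMap y + (l : ℂ) • mulMap hP y) ((l : ℂ) • primMap hP y)
    have e2 := Lp.coeFn_add (derivMap y) ((l : ℂ) • mulMap hP y)
    filter_upwards [e1, e2, Lp.coeFn_smul (l : ℂ) (mulMap hP y),
      Lp.coeFn_smul (l : ℂ) (primMap hP y), coeFn_derivMap y, coeFn_mulMap hP y,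
      coeFn_primMap hP y, ae_restrict_mem measurableSet_Icc] with x e1 e2 e3 e4 e5 e6 e7 hx
    have e0 : h x = deriv (y : ℝ → ℂ) x + l * (P x * (y : ℝ → ℂ) x) -
        l * ∫ t in (0 : ℝ)..x, (P t : ℂ) * deriv (y : ℝ → ℂ) t := by
      rw [show h = derivMap y + (l : ℂ) • mulMap hP y - (l : ℂ) • primMap hP y from rfl, e1,
        Pi.sub_apply, e2, Pi.add_apply, e3, e4, Pi.smul_apply, Pi.smul_apply, e5, e6, e7]
      simp
    have e8 : deriv (y : ℝ → ℂ) x = h x - l * (P x * (y : ℝ → ℂ) x) +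
        l * ∫ t in (0 : ℝ)..x, (P t : ℂ) * deriv (y : ℝ → ℂ) t := by
      rw [e0]; ring
    have e9 : ‖(l : ℂ) * (P x * (y : ℝ → ℂ) x)‖ ≤ |l| * (‖P x‖ * G x) := by
      rw [norm_mul, norm_mul, Complex.norm_real, Complex.norm_real, Real.norm_eq_abs l]
      gcongr
      exact hyG x hx
    have e10 : ‖(l : ℂ) * ∫ t in (0 : ℝ)..x, (P t : ℂ) * deriv (y : ℝ → ℂ) t‖ ≤ |l| * G x := by
      rw [norm_mul, Complex.norm_real, Real.norm_eq_abs l]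
      gcongr
      exact hKG x hx
    rw [e8]
    refine (norm_add_le _ _).trans ?_
    have e11 := norm_sub_le (h x) ((l : ℂ) * (P x * (y : ℝ → ℂ) x))
    simp only [hpdef]
    nlinarith
  have hGbound : ∀ x ∈ Set.Icc (0 : ℝ) 1, G x ≤ 2 * (A * ‖h‖) * E := by
    intro x hx
    refine gronwall_integral hφ (fun x => by simp only [hφdef]; positivity) hGc (by positivity)
      (fun x hx => ?_) hx
    have hφG : Integrable (fun t => φ t * G t) unitMeasure :=
      IntegrableOn.mul_continuousOn hφ hGc isCompact_Icc
    have i1 := intervalIntegrable_of_integrable hph (x := 0) (by simp) hx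
    have i2 := intervalIntegrable_of_integrable hφG (x := 0) (by simp) hx
    have h1 : G x ≤ ∫ t in (0 : ℝ)..x, (p t * ‖h t‖ + φ t * G t) := by
      refine intervalIntegral.integral_mono_ae_restrict hx.1
        (intervalIntegrable_of_integrable hpy (by simp) hx) (i1.add i2) ?_
      have := ae_restrict_of_ae_restrict_of_subset
        (Set.Icc_subset_Icc_right hx.2 : Set.Icc 0 x ⊆ Set.Icc 0 1) hae
      filter_upwards [this] with t ht
      have := mul_le_mul_of_nonneg_left ht (hp0 t)
      simp only [hφdef]
      nlinarith
    rw [intervalIntegral.integral_add i1 i2] at h1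
    have h2 : ∫ t in (0 : ℝ)..x, p t * ‖h t‖ ≤ A * ‖h‖ := by
      have h3 := primitive_mono hph (fun t => mul_nonneg (hp0 t) (norm_nonneg _)) hx
        (by simp : (1 : ℝ) ∈ Set.Icc (0 : ℝ) 1) hx.2
      rw [intervalIntegral_eq_unitMeasure] at h3
      have h4 := integral_mul_le_norm_toLp hp hhL.norm
      rw [norm_toLp_norm hhL, Lp.toLp_coeFn] at h4
      linarith
    linarith
  have hfin : ‖derivMap y‖ ≤
      ‖hhL.norm.toLp (fun x => ‖h x‖) + (|l| * (2 * (A * ‖h‖) * E)) • hp.toLp p‖ := by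
    refine Lp.norm_le_norm_of_ae_le ?_
    filter_upwards [Lp.coeFn_add (hhL.norm.toLp (fun x => ‖h x‖))
      ((|l| * (2 * (A * ‖h‖) * E)) • hp.toLp p),
      Lp.coeFn_smul (|l| * (2 * (A * ‖h‖) * E)) (hp.toLp p), hhL.norm.coeFn_toLp, hp.coeFn_toLp,
      coeFn_derivMap y, hae, ae_restrict_mem measurableSet_Icc] with x e1 e2 e3 e4 e5 e6 hx
    rw [e1, Pi.add_apply, e2, Pi.smul_apply, e3, e4, e5, smul_eq_mul]
    refine e6.trans ((add_le_add_right ?_ _).trans (le_abs_self _))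
    have := mul_le_mul_of_nonneg_left (hGbound x hx) (hp0 x)
    calc |l| * (p x * G x) ≤ |l| * (p x * (2 * (A * ‖h‖) * E)) := by gcongr
      _ = _ := by ring
  refine hfin.trans ((norm_add_le _ _).trans (le_of_eq ?_))
  rw [norm_toLp_norm hhL, Lp.toLp_coeFn, norm_smul, Real.norm_of_nonneg (by positivity)]
  ring

/-- The constant function one in `L₂[0,1]`. -/
noncomputable def oneL2 : L2Unit := (memLp_const (1 : ℂ)).toLp _

lemma coeFn_oneL2 : oneL2 =ᵐ[unitMeasure] fun _ => 1 := (memLp_const (1 : ℂ)).coeFn_toLp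

lemma inner_oneL2 (g : L2Unit) : inner ℂ oneL2 g = ∫ x, g x ∂unitMeasure := by
  rw [L2.inner_def]
  refine integral_congr_ae ?_
  filter_upwards [coeFn_oneL2] with x hx
  rw [hx]
  simp

lemma exists_derivMap_eq {g : L2Unit} (hg : inner ℂ oneL2 g = 0) :
    ∃ z : sobolevZero, derivMap z = g := by
  rw [inner_oneL2] at hg
  obtain ⟨z, hz⟩ := exists_primitive (Lp.memLp g) hg
  exact ⟨z, Lp.ext ((coeFn_derivMap z).trans hz)⟩

include hP in
/-- The negative index changes by at most one near every value of the parameter. -/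
lemma eventually_negIndex {l₀ : ℝ} {m : ℕ} (hm : negIndex P l₀ = m) :
    ∀ᶠ l in 𝓝 l₀, (m : ℕ∞) ≤ negIndex P l ∧ negIndex P l ≤ (m + 1 : ℕ) := by
  simp only [negIndex_eq hP] at hm ⊢
  obtain ⟨C, hC, hbound⟩ := exists_norm_derivMap_le hP l₀
  have h1 := eventually_le_negInd isHermForm_energyForm (isHermForm_weightForm hP)
    (by positivity) (norm_weightForm_le hP) hm.ge
  have h2 := eventually_negInd_le isHermForm_energyForm (isHermForm_weightForm hP)
    (fun y => by rw [re_energyForm_self]; positivity) norm_energyForm_le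
    (by positivity) (norm_weightForm_le hP) (l₀ := l₀)
    (ℓ := (innerₛₗ ℂ oneL2) ∘ₗ quasiDeriv hP l₀) (C := C ^ 2) (by positivity)
    (fun y hy => by
      -- test the form against the primitive of the quasi-derivative
      obtain ⟨z, hz⟩ := exists_derivMap_eq (g := quasiDeriv hP l₀ y) hy
      refine ⟨z, ?_⟩
      have h3 : ((energyForm + (l₀ : ℂ) • weightForm hP) y z).re = ‖quasiDeriv hP l₀ y‖ ^ 2 := by
        rw [form_eq_inner_quasiDeriv, hz]
        exact inner_self_eq_norm_sq (𝕜 := ℂ) (quasiDeriv hP l₀ y)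
      rw [h3, re_energyForm_self, re_energyForm_self, hz, ← mul_pow]
      exact ⟨le_rfl, pow_le_pow_left₀ (norm_nonneg _) (hbound y) 2⟩) hm
  filter_upwards [h1, h2] with l h1 h2
  exact ⟨h1, h2⟩

end UniqueContinuation

/-! ### The recursion for the index of a self-similar weight -/

section Partition

variable {n : ℕ} {a : Fin n → ℝ}

/-- The partition points `∑_{i<j} a_i`, indexed by natural numbers. -/
noncomputable def partPoint (a : Fin n → ℝ) (j : ℕ) : ℝ :=
  ∑ i ∈ Finset.univ.filter (fun i : Fin n => (i : ℕ) < j), a i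

lemma leftEnd_eq_partPoint (k : Fin n) : leftEnd a k = partPoint a k := rfl

lemma partPoint_succ (k : Fin n) : partPoint a (k + 1) = leftEnd a k + a k := by
  have h : Finset.univ.filter (fun i : Fin n => (i : ℕ) < k + 1) =
      insert k (Finset.univ.filter (fun i : Fin n => (i : ℕ) < k)) := by
    ext i
    simp only [Finset.mem_filter, Finset.mem_univ, true_and, Finset.mem_insert, Fin.ext_iff]
    omega
  rw [partPoint, h, Finset.sum_insert (by simp), add_comm, leftEnd_eq_partPoint, partPoint]

lemma partPoint_zero : partPoint a 0 = 0 := by simp [partPoint]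

lemma partPoint_self : partPoint a n = ∑ k, a k := by simp [partPoint]

lemma partPoint_mono (ha : ∀ k, 0 < a k) : Monotone (partPoint a) := fun i j hij =>
  Finset.sum_le_sum_of_subset_of_nonneg
    (fun k hk => by simp only [Finset.mem_filter] at hk ⊢; exact ⟨hk.1, hk.2.trans_le hij⟩)
    fun k _ _ => (ha k).le

lemma partPoint_mem (ha : ∀ k, 0 < a k) (hsum : ∑ k, a k = 1) {j : ℕ} (hj : j ≤ n) :
    partPoint a j ∈ Set.Icc (0 : ℝ) 1 := by
  have h1 := partPoint_mono ha (Nat.zero_le j)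
  have h2 := partPoint_mono ha hj
  rw [partPoint_zero] at h1
  rw [partPoint_self, hsum] at h2
  exact ⟨h1, h2⟩

lemma leftEnd_nonneg (ha : ∀ k, 0 < a k) (hsum : ∑ k, a k = 1) (k : Fin n) : 0 ≤ leftEnd a k :=
  (partPoint_mem ha hsum k.2.le).1

lemma rightEnd_le_one (ha : ∀ k, 0 < a k) (hsum : ∑ k, a k = 1) (k : Fin n) :
    leftEnd a k + a k ≤ 1 := by
  rw [← partPoint_succ]
  exact (partPoint_mem ha hsum k.2).2

lemma eq_of_mem_Ioo (ha : ∀ k, 0 < a k) {j k : Fin n} {x : ℝ}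
    (hj : x ∈ Set.Ioo (leftEnd a j) (leftEnd a j + a j))
    (hk : x ∈ Set.Ioo (leftEnd a k) (leftEnd a k + a k)) : j = k := by
  rw [← partPoint_succ, leftEnd_eq_partPoint] at hj hk
  by_contra hne
  rcases lt_or_gt_of_ne (fun h => hne (Fin.ext h) : (j : ℕ) ≠ k) with h | h
  · have := partPoint_mono ha (show (j : ℕ) + 1 ≤ k from h)
    linarith [hj.2, hk.1]
  · have := partPoint_mono ha (show (k : ℕ) + 1 ≤ j from h)
    linarith [hk.2, hj.1]

lemma affine_mem_Ioo (ha : ∀ k, 0 < a k) (k : Fin n) {s : ℝ} (hs : s ∈ Set.Ioo (0 : ℝ) 1) :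
    a k * s + leftEnd a k ∈ Set.Ioo (leftEnd a k) (leftEnd a k + a k) := by
  have := ha k
  constructor
  · nlinarith [hs.1]
  · nlinarith [hs.2]

lemma integral_eq_sum_partition (ha : ∀ k, 0 < a k) (hsum : ∑ k, a k = 1) {F : ℝ → ℝ}
    (hF : Integrable F unitMeasure) :
    ∫ x, F x ∂unitMeasure = ∑ k, ∫ x in (leftEnd a k)..(leftEnd a k + a k), F x := by
  have h := intervalIntegral.sum_integral_adjacent_intervals (μ := volume) (f := F)
    (a := partPoint a) (n := n) fun j hj => intervalIntegrable_of_integrable hF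
      (partPoint_mem ha hsum hj.le) (partPoint_mem ha hsum hj)
  rw [partPoint_zero, partPoint_self, hsum, intervalIntegral_eq_unitMeasure] at h
  rw [← h, Finset.sum_range]
  exact Finset.sum_congr rfl fun k _ => by rw [partPoint_succ, leftEnd_eq_partPoint]

lemma quasiMeasurePreserving_affine {c : ℝ} (hc : c ≠ 0) (b : ℝ) :
    Measure.QuasiMeasurePreserving (fun t : ℝ => c * t + b) volume volume := by
  have h1 : Measure.QuasiMeasurePreserving (fun t : ℝ => c * t) volume volume := by
    refine ⟨measurable_const_mul c, ?_⟩
    rw [Real.map_volume_mul_left hc]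
    exact Measure.smul_absolutelyContinuous
  exact (measurePreserving_add_right volume b).quasiMeasurePreserving.comp h1

lemma memLp_comp_affine {f : ℝ → ℂ} (hf : MemLp f 2 volume) {c : ℝ} (hc : c ≠ 0) (b : ℝ) :
    MemLp (fun t => f (c * t + b)) 2 volume := by
  have hm : AEStronglyMeasurable (fun t => f (c * t + b)) volume :=
    hf.1.comp_quasiMeasurePreserving (quasiMeasurePreserving_affine hc b)
  rw [memLp_two_iff_integrable_sq_norm hm]
  have h1 := (memLp_two_iff_integrable_sq_norm hf.1).1 hf
  exact (h1.comp_add_right b).comp_mul_left' hc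

/-- On each interval of the partition, almost everywhere, `P` is an affine image of itself. -/
lemma IsSelfSimilar.ae_eq {d β : Fin n → ℝ} {P : ℝ → ℝ} (hP : IsSelfSimilar a d β P) (k : Fin n) :
    ∀ᵐ s ∂unitMeasure, P (a k * s + leftEnd a k) = d k * P s + β k := by
  have h1 := (ae_restrict_iff' measurableSet_Icc).1 hP.fixed
  have h2 := (quasiMeasurePreserving_affine (hP.pos k).ne' (leftEnd a k)).ae h1
  filter_upwards [ae_restrict_of_ae h2, ae_unitMeasure_mem_Ioo] with s hs hs01
  have hmem := affine_mem_Ioo hP.pos k hs01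
  rw [hs ⟨(leftEnd_nonneg hP.pos hP.sum_eq_one k).trans hmem.1.le,
    hmem.2.le.trans (rightEnd_le_one hP.pos hP.sum_eq_one k)⟩, similarityOp,
    Finset.sum_eq_single k]
  · rw [Set.indicator_of_mem hmem]
    have : (a k * s + leftEnd a k - leftEnd a k) / a k = s := by
      have := (hP.pos k).ne'
      field_simp
      ring
    rw [this]
  · intro j _ hj
    exact Set.indicator_of_notMem (fun h => hj (eq_of_mem_Ioo hP.pos h hmem)) _
  · simp

end Partition

section Localization

/-- The derivative of an element of the Sobolev space, extended by zero. -/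
noncomputable def derivExt (y : sobolevZero) : ℝ → ℂ :=
  (Set.Ioo (0 : ℝ) 1).indicator (deriv (y : ℝ → ℂ))

lemma memLp_derivExt (y : sobolevZero) : MemLp (derivExt y) 2 volume := by
  rw [derivExt, memLp_indicator_iff_restrict measurableSet_Ioo, restrict_Ioo_eq_restrict_Icc]
  exact memLp_deriv y

lemma intervalIntegrable_derivExt (y : sobolevZero) (s t : ℝ) :
    IntervalIntegrable (derivExt y) volume s t :=
  (((memLp_derivExt y).locallyIntegrable (by norm_num)).integrableOn_isCompact
    isCompact_uIcc).intervalIntegrable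

lemma apply_eq_integral_derivExt (y : sobolevZero) (x : ℝ) :
    (y : ℝ → ℂ) x = ∫ t in (0 : ℝ)..x, derivExt y t := by
  have hin : ∀ x ∈ Set.Icc (0 : ℝ) 1, (y : ℝ → ℂ) x = ∫ t in (0 : ℝ)..x, derivExt y t := by
    intro x hx
    rw [apply_eq_integral_deriv y hx]
    refine intervalIntegral.integral_congr_ae ?_
    filter_upwards [Measure.ae_ne volume (1 : ℝ)] with t ht1 ht
    rw [Set.uIoc_of_le hx.1] at ht
    have htm : t ∈ Set.Ioo (0 : ℝ) 1 := ⟨ht.1, lt_of_le_of_ne (ht.2.trans hx.2) ht1⟩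
    rw [derivExt, Set.indicator_of_mem htm]
  have hzero : ∀ s t : ℝ, (∀ x ∈ Set.uIcc s t, x ∉ Set.Ioo (0 : ℝ) 1) →
      ∫ t in s..t, derivExt y t = 0 := by
    intro s t h
    have h1 : ∫ t in s..t, derivExt y t = ∫ _ in s..t, (0 : ℂ) :=
      intervalIntegral.integral_congr fun x hx => Set.indicator_of_notMem (h x hx) _
    rw [h1, intervalIntegral.integral_zero]
  rcases lt_or_ge x 0 with h0 | h0
  · rw [hzero 0 x fun t ht => ?_, apply_eq_zero y fun h => by linarith [h.1]]
    rw [Set.uIcc_of_ge h0.le] at ht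
    exact fun h => by linarith [h.1, ht.2]
  · rcases le_or_gt x 1 with h1 | h1
    · exact hin x ⟨h0, h1⟩
    · rw [← intervalIntegral.integral_add_adjacent_intervals
        (intervalIntegrable_derivExt y 0 1) (intervalIntegrable_derivExt y 1 x),
        ← hin 1 (by simp), hzero 1 x fun t ht => ?_, apply_eq_zero y fun h => by linarith [h.2],
        apply_eq_zero y (by simp), add_zero]
      rw [Set.uIcc_of_le h1.le] at ht
      exact fun h => by linarith [h.2, ht.1]

/-- An affine substitution in the primitive of the derivative. -/
lemma integral_derivExt_affine (y : sobolevZero) {c : ℝ} (hc : c ≠ 0) (b x : ℝ) :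
    ∫ t in (0 : ℝ)..x, (c : ℂ) • derivExt y (c * t + b) =
      (y : ℝ → ℂ) (c * x + b) - (y : ℝ → ℂ) b := by
  rw [intervalIntegral.integral_smul, intervalIntegral.integral_comp_mul_add _ hc, mul_zero,
    zero_add, apply_eq_integral_derivExt y (c * x + b), apply_eq_integral_derivExt y b,
    intervalIntegral.integral_interval_sub_left (intervalIntegrable_derivExt y _ _)
      (intervalIntegrable_derivExt y _ _), Complex.real_smul, smul_eq_mul, ← mul_assoc]
  push_cast
  rw [mul_inv_cancel₀ (by exact_mod_cast hc), one_mul]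

/-- The copy of an element of the Sobolev space, transplanted to the interval `[α, α + c]` and
extended by zero. -/
noncomputable def transplant {α c : ℝ} (hα : 0 ≤ α) (hc : 0 < c) (h1 : α + c ≤ 1) :
    sobolevZero →ₗ[ℂ] sobolevZero where
  toFun u := ⟨fun x => (u : ℝ → ℂ) (c⁻¹ * x + -(c⁻¹ * α)), by
    have haff : ∀ x, c * (c⁻¹ * x + -(c⁻¹ * α)) = x - α := fun x => by
      have := hc.ne'
      field_simp
      ring
    refine ⟨fun x hx => apply_eq_zero u fun h => hx ?_,
      fun t => ((c⁻¹ : ℝ) : ℂ) • derivExt u (c⁻¹ * t + -(c⁻¹ * α)), ?_, fun x _ => ?_⟩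
    · have h2 := haff x
      constructor <;> nlinarith [h.1, h.2]
    · exact ((memLp_comp_affine (memLp_derivExt u) (inv_ne_zero hc.ne') _).const_smul
        ((c⁻¹ : ℝ) : ℂ)).restrict _
    · rw [integral_derivExt_affine u (inv_ne_zero hc.ne'), apply_eq_zero u (x := -(c⁻¹ * α)),
        sub_zero]
      intro h
      have : 0 ≤ c⁻¹ * α := by positivity
      linarith [h.1]⟩
  map_add' u v := rfl
  map_smul' r u := rfl

lemma transplant_apply {α c : ℝ} (hα : 0 ≤ α) (hc : 0 < c) (h1 : α + c ≤ 1) (u : sobolevZero)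
    (x : ℝ) : (transplant hα hc h1 u : ℝ → ℂ) x = (u : ℝ → ℂ) (c⁻¹ * x + -(c⁻¹ * α)) := rfl

lemma rescale_mem {α c : ℝ} (hc : 0 < c) (y : sobolevZero)
    (h0 : (y : ℝ → ℂ) α = 0) (h1 : (y : ℝ → ℂ) (c + α) = 0) :
    (Set.Ioo (0 : ℝ) 1).indicator (fun s => (y : ℝ → ℂ) (c * s + α)) ∈ sobolevZero := by
  refine ⟨fun x hx => Set.indicator_of_notMem hx _, fun t => (c : ℂ) • derivExt y (c * t + α),
    ((memLp_comp_affine (memLp_derivExt y) hc.ne' α).const_smul (c : ℂ)).restrict _,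
    fun x hx => ?_⟩
  rw [integral_derivExt_affine y hc.ne', h0, sub_zero]
  by_cases hx' : x ∈ Set.Ioo (0 : ℝ) 1
  · rw [Set.indicator_of_mem hx']
  · rw [Set.indicator_of_notMem hx']
    rcases hx.1.eq_or_lt with rfl | h2
    · rw [mul_zero, zero_add, h0]
    · obtain rfl : x = 1 := le_antisymm hx.2 (not_lt.1 fun h3 => hx' ⟨h2, h3⟩)
      rw [mul_one, h1]

/-- The density of the quadratic form of the pencil. -/
noncomputable def density (P : ℝ → ℝ) (l : ℝ) (y : sobolevZero) (x : ℝ) : ℝ :=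
  ‖deriv (y : ℝ → ℂ) x‖ ^ 2 +
    l * (P x * (2 * (deriv (y : ℝ → ℂ) x * star ((y : ℝ → ℂ) x)).re))

variable {P : ℝ → ℝ} (hP : MemLp P 2 unitMeasure)

include hP in
lemma integrable_density (l : ℝ) (y : sobolevZero) : Integrable (density P l y) unitMeasure := by
  have h1 : Integrable (fun x => ‖deriv (y : ℝ → ℂ) x‖ ^ 2) unitMeasure :=
    (memLp_deriv y).integrable_norm_pow (by norm_num)
  have h2 : Integrable (fun x => ((P x : ℂ) *
      (deriv (y : ℝ → ℂ) x * star ((y : ℝ → ℂ) x))).re) unitMeasure := (integrable_weight hP y y).re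
  refine (h1.add (h2.const_mul (l * 2))).congr (Eventually.of_forall fun x => ?_)
  simp only [Pi.add_apply, density, Complex.re_ofReal_mul]
  ring

lemma re_form_eq_integral_density (l : ℝ) (y : sobolevZero) :
    ((energyForm + (l : ℂ) • weightForm hP) y y).re = ∫ x, density P l y x ∂unitMeasure := by
  rw [← pencil_eq_form, pencil, intervalIntegral_eq_unitMeasure]
  have h1 : ∀ x, deriv (y : ℝ → ℂ) x * star (deriv (y : ℝ → ℂ) x) +
      (l : ℂ) * (P x : ℂ) * (deriv (y : ℝ → ℂ) x * star ((y : ℝ → ℂ) x) +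
        (y : ℝ → ℂ) x * star (deriv (y : ℝ → ℂ) x)) = ((density P l y x : ℝ) : ℂ) := by
    intro x
    have h2 : (y : ℝ → ℂ) x * star (deriv (y : ℝ → ℂ) x) =
        star (deriv (y : ℝ → ℂ) x * star ((y : ℝ → ℂ) x)) := by
      rw [star_mul, star_star]
    rw [h2, density]
    simp only [Complex.star_def]
    rw [Complex.mul_conj', Complex.add_conj]
    push_cast
    ring
  simp_rw [h1]
  rw [integral_complex_ofReal, Complex.ofReal_re]

lemma integral_re_deriv_mul_star (u : sobolevZero) :
    ∫ x, (deriv (u : ℝ → ℂ) x * star ((u : ℝ → ℂ) x)).re ∂unitMeasure = 0 := by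
  have hu := integrable_unit (memLp_deriv u)
  have h1 := integral_mul_star_eq _ hu u
  have hi1 : Integrable (fun x => deriv (u : ℝ → ℂ) x * star ((u : ℝ → ℂ) x)) unitMeasure :=
    integrable_mul_continuousOn hu (continuous_star.comp_continuousOn (continuousOn_coe u))
  have h2 : ∫ x, (∫ t in (0 : ℝ)..x, deriv (u : ℝ → ℂ) t) *
      star (deriv (u : ℝ → ℂ) x) ∂unitMeasure =
      star (∫ x, deriv (u : ℝ → ℂ) x * star ((u : ℝ → ℂ) x) ∂unitMeasure) := by
    rw [Complex.star_def, ← integral_conj]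
    refine integral_congr_ae ?_
    filter_upwards [ae_restrict_mem measurableSet_Icc] with x hx
    rw [← apply_eq_integral_deriv u hx]
    simp [mul_comm]
  rw [h2] at h1
  have h3 := congrArg Complex.re h1
  have h5 : (star (∫ x, deriv (u : ℝ → ℂ) x * star ((u : ℝ → ℂ) x) ∂unitMeasure)).re =
      (∫ x, deriv (u : ℝ → ℂ) x * star ((u : ℝ → ℂ) x) ∂unitMeasure).re := Complex.conj_re _
  rw [Complex.neg_re, h5] at h3
  have h4 : ∫ x, (deriv (u : ℝ → ℂ) x * star ((u : ℝ → ℂ) x)).re ∂unitMeasure =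
      (∫ x, deriv (u : ℝ → ℂ) x * star ((u : ℝ → ℂ) x) ∂unitMeasure).re :=
    Complex.reCLM.integral_comp_comm hi1
  rw [h4]
  linarith

include hP in
/-- The transformation of the quadratic form under an affine change of variable that turns `P`
into `D P + b`; the constant `b` does not contribute. -/
lemma integral_density_affine {α c D b l : ℝ} (hc : 0 < c)
    (hPs : ∀ᵐ s ∂unitMeasure, P (c * s + α) = D * P s + b) {y u : sobolevZero}
    (hyu : ∀ s ∈ Set.Ioo (0 : ℝ) 1, (y : ℝ → ℂ) (c * s + α) = (u : ℝ → ℂ) s) :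
    ∫ x in α..(α + c), density P l y x =
      c⁻¹ * ∫ s, density P (c * D * l) u s ∂unitMeasure := by
  have h1 := intervalIntegral.integral_comp_mul_add (a := 0) (b := 1) (density P l y) hc.ne' α
  rw [mul_zero, zero_add, mul_one, add_comm c α, intervalIntegral_eq_unitMeasure] at h1
  have h2 : ∫ x in α..(α + c), density P l y x =
      c * ∫ s, density P l y (c * s + α) ∂unitMeasure := by
    rw [h1, smul_eq_mul, ← mul_assoc, mul_inv_cancel₀ hc.ne', one_mul]
  have hu0 : Integrable (fun s => (deriv (u : ℝ → ℂ) s * star ((u : ℝ → ℂ) s)).re) unitMeasure :=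
    (integrable_mul_continuousOn (integrable_unit (memLp_deriv u))
      (continuous_star.comp_continuousOn (continuousOn_coe u))).re
  have h3 : ∫ s, density P l y (c * s + α) ∂unitMeasure =
      ∫ s, ((c ^ 2)⁻¹ * density P (c * D * l) u s +
        c⁻¹ * l * b * 2 * (deriv (u : ℝ → ℂ) s * star ((u : ℝ → ℂ) s)).re) ∂unitMeasure := by
    refine integral_congr_ae ?_
    filter_upwards [hPs, ae_unitMeasure_mem_Ioo] with s hs hs01
    have hder : deriv (u : ℝ → ℂ) s = (c : ℂ) * deriv (y : ℝ → ℂ) (c * s + α) := by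
      have h4 : (fun s => (y : ℝ → ℂ) (c * s + α)) =ᶠ[𝓝 s] (u : ℝ → ℂ) := by
        filter_upwards [Ioo_mem_nhds hs01.1 hs01.2] with t ht
        exact hyu t ht
      rw [← h4.deriv_eq, deriv_comp_mul_left c (fun t => (y : ℝ → ℂ) (t + α)) s,
        deriv_comp_add_const, Complex.real_smul]
    have hc' : (c : ℂ) ≠ 0 := by exact_mod_cast hc.ne'
    have hder' : deriv (y : ℝ → ℂ) (c * s + α) = ((c⁻¹ : ℝ) : ℂ) * deriv (u : ℝ → ℂ) s := by
      rw [hder]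
      push_cast
      field_simp
    simp only [density]
    rw [hder', hs, hyu s hs01, norm_mul, mul_assoc (((c⁻¹ : ℝ) : ℂ)), Complex.re_ofReal_mul,
      Complex.norm_real, Real.norm_of_nonneg (inv_nonneg.2 hc.le)]
    have := hc.ne'
    field_simp
    ring
  rw [h2, h3, integral_add ((integrable_density hP _ u).const_mul _) (hu0.const_mul _),
    integral_const_mul, integral_const_mul, integral_re_deriv_mul_star, mul_zero, add_zero]
  have := hc.ne'
  field_simp

end Localization

section Recursion

variable {n : ℕ} {a d β : Fin n → ℝ} {P : ℝ → ℝ}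

/-- The decomposition of the quadratic form along the partition. -/
lemma IsSelfSimilar.re_form_eq_sum (hP : IsSelfSimilar a d β P) (l : ℝ) {y : sobolevZero}
    {u : Fin n → sobolevZero} (hyu : ∀ k, ∀ s ∈ Set.Ioo (0 : ℝ) 1,
      (y : ℝ → ℂ) (a k * s + leftEnd a k) = (u k : ℝ → ℂ) s) :
    ((energyForm + (l : ℂ) • weightForm hP.memLp) y y).re = ∑ k, (a k)⁻¹ *
      ((energyForm + ((a k * d k * l : ℝ) : ℂ) • weightForm hP.memLp) (u k) (u k)).re := by
  rw [re_form_eq_integral_density, integral_eq_sum_partition hP.pos hP.sum_eq_one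
    (integrable_density hP.memLp l y)]
  refine Finset.sum_congr rfl fun k _ => ?_
  rw [re_form_eq_integral_density]
  exact integral_density_affine hP.memLp (hP.pos k) (hP.ae_eq k) (hyu k)

/-- The upper estimate: on the functions vanishing at all partition points, which form a subspace
of codimension at most `n`, the form splits into a sum over the partition. -/
lemma IsSelfSimilar.negIndex_le (hP : IsSelfSimilar a d β P) {l : ℝ} {m : Fin n → ℕ}
    (hm : ∀ k, negIndex P (a k * d k * l) = m k) :
    negIndex P l ≤ ((∑ k, m k + n : ℕ) : ℕ∞) := by
  simp only [negIndex_eq hP.memLp] at hm ⊢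
  have hφ := fun k => exists_nonneg_on_ker
    (isHermForm_energyForm.add_smul (isHermForm_weightForm hP.memLp) _) (hm k)
  choose φ hφ using hφ
  let ev : sobolevZero →ₗ[ℂ] (Fin n → ℂ) :=
    { toFun := fun y k => (y : ℝ → ℂ) (leftEnd a k)
      map_add' := fun _ _ => rfl
      map_smul' := fun _ _ => rfl }
  have hev : ∀ y ∈ LinearMap.ker ev, ∀ k, (y : ℝ → ℂ) (leftEnd a k) = 0 := fun y hy k =>
    congrFun (LinearMap.mem_ker.1 hy) k
  have hev' : ∀ y ∈ LinearMap.ker ev, ∀ k, (y : ℝ → ℂ) (a k + leftEnd a k) = 0 := by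
    intro y hy k
    rw [add_comm, ← partPoint_succ]
    by_cases hk : (k : ℕ) + 1 < n
    · exact hev y hy ⟨k + 1, hk⟩
    · have : (k : ℕ) + 1 = n := by have := k.2; omega
      rw [this, partPoint_self, hP.sum_eq_one]
      exact apply_eq_zero y (by simp)
  let res : Fin n → LinearMap.ker ev →ₗ[ℂ] sobolevZero := fun k =>
    { toFun := fun y => ⟨_, rescale_mem (hP.pos k) (y : sobolevZero) (hev y y.2 k) (hev' y y.2 k)⟩
      map_add' := fun y z => by
        ext s
        by_cases hs : s ∈ Set.Ioo (0 : ℝ) 1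
        · simp [hs]
        · simp [hs]
      map_smul' := fun c y => by
        ext s
        by_cases hs : s ∈ Set.Ioo (0 : ℝ) 1
        · simp [hs]
        · simp [hs] }
  obtain ⟨Φ, hΦ⟩ := LinearMap.exists_extend (LinearMap.pi fun k => φ k ∘ₗ res k :
    LinearMap.ker ev →ₗ[ℂ] ((k : Fin n) → Fin (m k) → ℂ))
  have := negInd_le_finrank (energyForm + (l : ℂ) • weightForm hP.memLp) (ev.prod Φ)
    (fun y hy => by
      obtain ⟨hy1, hy2⟩ := Prod.mk.inj (hy : (_, _) =
        ((0, 0) : (Fin n → ℂ) × ((k : Fin n) → Fin (m k) → ℂ)))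
      have hmem : y ∈ LinearMap.ker ev := hy1
      rw [hP.re_form_eq_sum l (u := fun k => res k ⟨y, hmem⟩) fun k s hs =>
        (Set.indicator_of_mem hs fun s => (y : ℝ → ℂ) (a k * s + leftEnd a k)).symm]
      refine Finset.sum_nonneg fun k _ => mul_nonneg (inv_nonneg.2 (hP.pos k).le) (hφ k _ ?_)
      have h1 := LinearMap.congr_fun hΦ ⟨y, hmem⟩
      have h2 : Φ y = LinearMap.pi (fun k => φ k ∘ₗ res k) ⟨y, hmem⟩ := h1
      rw [hy2] at h2
      exact (congrFun h2 k).symm)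
  refine this.trans (le_of_eq ?_)
  simp [Module.finrank_prod, Module.finrank_pi_fintype, add_comm]

/-- The lower estimate: negative subspaces for the rescaled parameters are transplanted to the
intervals of the partition. -/
lemma IsSelfSimilar.le_negIndex (hP : IsSelfSimilar a d β P) {l : ℝ} {m : Fin n → ℕ}
    (hm : ∀ k, negIndex P (a k * d k * l) = m k) :
    ((∑ k, m k : ℕ) : ℕ∞) ≤ negIndex P l := by
  simp only [negIndex_eq hP.memLp] at hm ⊢
  have hv := fun k => exists_isNegOrthonormal
    (isHermForm_energyForm.add_smul (isHermForm_weightForm hP.memLp) _) (hm k).ge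
  choose v hv using hv
  let ext : Fin n → sobolevZero →ₗ[ℂ] sobolevZero := fun k =>
    transplant (leftEnd_nonneg hP.pos hP.sum_eq_one k) (hP.pos k)
      (rightEnd_le_one hP.pos hP.sum_eq_one k)
  let f : ((k : Fin n) → Fin (m k) → ℂ) →ₗ[ℂ] sobolevZero :=
    ∑ k, ext k ∘ₗ Fintype.linearCombination ℂ (v k) ∘ₗ LinearMap.proj k
  have := finrank_le_negInd (energyForm + (l : ℂ) • weightForm hP.memLp) f (fun c hc => by
    have hf : f c = ∑ k, ext k (∑ i, c k i • v k i) := by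
      simp [f, LinearMap.sum_apply, Fintype.linearCombination_apply]
    rw [hP.re_form_eq_sum l (u := fun k => ∑ i, c k i • v k i) fun k s hs => by
      have hmem := affine_mem_Ioo hP.pos k hs
      have h1 : (f c : ℝ → ℂ) (a k * s + leftEnd a k) =
          ∑ j, (ext j (∑ i, c j i • v j i) : ℝ → ℂ) (a k * s + leftEnd a k) := by
        rw [hf, Submodule.coe_sum, Finset.sum_apply]
      rw [h1, Finset.sum_eq_single k]
      · rw [transplant_apply]
        have h2 : (a k)⁻¹ * (a k * s + leftEnd a k) + -((a k)⁻¹ * leftEnd a k) = s := by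
          have := (hP.pos k).ne'
          field_simp
          ring
        rw [h2]
      · intro j _ hj
        rw [transplant_apply]
        refine apply_eq_zero _ fun h => hj (eq_of_mem_Ioo hP.pos ?_ hmem)
        have h2 := affine_mem_Ioo hP.pos j h
        have h3 : a j * ((a j)⁻¹ * (a k * s + leftEnd a k) + -((a j)⁻¹ * leftEnd a j)) +
            leftEnd a j = a k * s + leftEnd a k := by
          have := (hP.pos j).ne'
          field_simp
          ring
        rwa [h3] at h2
      · simp]
    simp_rw [(hv _).apply_sum_sum, mul_neg]
    rw [Finset.sum_neg_distrib, neg_lt_zero]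
    obtain ⟨k, hk⟩ := Function.ne_iff.1 hc
    obtain ⟨i, hi⟩ := Function.ne_iff.1 hk
    have hnn : ∀ k, 0 ≤ (a k)⁻¹ * ∑ i, ‖c k i‖ ^ 2 := fun k =>
      mul_nonneg (inv_nonneg.2 (hP.pos k).le) (Finset.sum_nonneg fun _ _ => by positivity)
    refine Finset.sum_pos' (fun k _ => hnn k) ⟨k, Finset.mem_univ _,
      mul_pos (inv_pos.2 (hP.pos k)) (Finset.sum_pos' (fun _ _ => by positivity)
        ⟨i, Finset.mem_univ _, ?_⟩)⟩
    have := norm_pos_iff.2 hi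
    positivity)
  refine le_trans (le_of_eq ?_) this
  rw [Module.finrank_pi_fintype]
  simp

lemma IsSelfSimilar.mul_abs_lt_one (hP : IsSelfSimilar a d β P) (k : Fin n) :
    a k * |d k| < 1 := by
  have h1 : a k * d k ^ 2 < 1 :=
    (Finset.single_le_sum (f := fun k => a k * d k ^ 2)
      (fun k _ => mul_nonneg (hP.pos k).le (sq_nonneg _)) (Finset.mem_univ k)).trans_lt
        hP.contraction
  have h2 : a k ≤ 1 := by
    rw [← hP.sum_eq_one]
    exact Finset.single_le_sum (f := a) (fun k _ => (hP.pos k).le) (Finset.mem_univ k)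
  have h3 := hP.pos k
  rw [← sq_abs] at h1
  by_contra! hcon
  nlinarith [abs_nonneg (d k)]

lemma IsSelfSimilar.exists_small (hP : IsSelfSimilar a d β P) :
    ∃ δ > 0, ∀ l, |l| < δ → negIndex P l = 0 := by
  refine ⟨1 / (2 * ‖hP.memLp.toLp P‖ + 1), by positivity, fun l hl =>
    negIndex_eq_zero hP.memLp ?_⟩
  rw [lt_div_iff₀ (by positivity)] at hl
  nlinarith [abs_nonneg l]

/-- Finiteness of the index: the recursion reduces the parameter by a fixed factor. -/
lemma IsSelfSimilar.negIndex_ne_top (hP : IsSelfSimilar a d β P) (l : ℝ) : negIndex P l ≠ ⊤ := by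
  obtain ⟨δ, hδ, hsmall⟩ := hP.exists_small
  obtain ⟨q, hq0, hq1, hq⟩ : ∃ q : ℝ, 0 ≤ q ∧ q < 1 ∧ ∀ k, a k * |d k| ≤ q := by
    rcases isEmpty_or_nonempty (Fin n) with hn | hn
    · exact ⟨0, le_rfl, one_pos, fun k => hn.elim k⟩
    · obtain ⟨k, hk⟩ := Finite.exists_max fun k => a k * |d k|
      exact ⟨a k * |d k|, mul_nonneg (hP.pos k).le (abs_nonneg _), hP.mul_abs_lt_one k, hk⟩
  have key : ∀ (j : ℕ) (l : ℝ), |l| * q ^ j < δ → negIndex P l ≠ ⊤ := by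
    intro j
    induction j with
    | zero =>
      intro l hl
      rw [hsmall l (by simpa using hl)]
      exact ENat.zero_ne_top
    | succ j ih =>
      intro l hl
      have h1 : ∀ k, negIndex P (a k * d k * l) ≠ ⊤ := by
        intro k
        refine ih _ (lt_of_le_of_lt ?_ hl)
        rw [abs_mul, abs_mul, abs_of_pos (hP.pos k), pow_succ]
        have h2 := mul_le_mul_of_nonneg_right (hq k)
          (mul_nonneg (abs_nonneg l) (pow_nonneg hq0 j))
        linarith
      have h2 := hP.negIndex_le (l := l) (m := fun k => (negIndex P (a k * d k * l)).toNat)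
        fun k => (ENat.natCast_toNat (h1 k)).symm
      exact (h2.trans_lt (ENat.natCast_lt_top _)).ne
  have hlim : Tendsto (fun j : ℕ => |l| * q ^ j) atTop (𝓝 0) := by
    simpa using (tendsto_pow_atTop_nhds_zero_of_lt_one hq0 hq1).const_mul |l|
  obtain ⟨j, hj⟩ := (hlim.eventually (gt_mem_nhds hδ)).exists
  exact key j l hj

end Recursion

/-! ### Nondegeneracy of the weight -/

section NonDegenerate

variable {P : ℝ → ℝ} (hP : MemLp P 2 unitMeasure)

/-- A Hermitian form with vanishing quadratic form vanishes. -/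
lemma IsHermForm.eq_zero_of_re_self {E : Type*} [AddCommGroup E] [Module ℂ E]
    {B : E →ₗ[ℂ] E →ₗ⋆[ℂ] ℂ} (hB : IsHermForm B) (h : ∀ y, (B y y).re = 0) (y z : E) :
    B y z = 0 := by
  have hre : ∀ y z, (B y z).re = 0 := by
    intro y z
    have h1 := h (y + z)
    have h2 := congrArg Complex.re (hB y z)
    simp only [map_add, LinearMap.add_apply, Complex.add_re, h, Complex.star_def,
      Complex.conj_re] at h1 h2
    linarith
  refine Complex.ext (hre y z) ?_
  have h3 := hre y (Complex.I • z)
  simpa [LinearMap.map_smulₛₗ] using h3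

lemma weightForm_eq_inner (y z : sobolevZero) :
    weightForm hP y z = inner ℂ (derivMap z) (mulMap hP y - primMap hP y) := by
  rw [weightForm_apply, inner_mulMap_derivMap, inner_sub_right]
  ring

lemma eq_smul_oneL2 {v : L2Unit} (hv : ∀ z : sobolevZero, inner ℂ (derivMap z) v = (0 : ℂ)) :
    v = (inner ℂ oneL2 v : ℂ) • oneL2 := by
  have h1 : (inner ℂ oneL2 oneL2 : ℂ) = 1 := by
    rw [inner_oneL2, integral_congr_ae coeFn_oneL2]
    simp
  set w := v - (inner ℂ oneL2 v : ℂ) • oneL2 with hw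
  have h2 : inner ℂ oneL2 w = (0 : ℂ) := by
    rw [hw, inner_sub_right, inner_smul_right, h1, mul_one, sub_self]
  obtain ⟨z, hz⟩ := exists_derivMap_eq h2
  have h3 : (inner ℂ w w : ℂ) = 0 := by
    have h4 : (inner ℂ w oneL2 : ℂ) = 0 := by rw [← inner_conj_symm, h2, map_zero]
    have h5 : (inner ℂ w v : ℂ) = 0 := by rw [← hz]; exact hv z
    conv_lhs => rw [hw]
    rw [inner_sub_right, ← hw, inner_smul_right, h4, h5, mul_zero, sub_zero]
  exact sub_eq_zero.1 (inner_self_eq_zero.1 h3)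

/-- If the form with weight `P'` vanishes, then `P y - ∫ P y'` is constant for every `y`. A
trapezoidal function `y` that is constant on `[δ, 1 - δ]` shows that `P` is constant there. -/
lemma exists_ae_eq_const (h : ∀ y z, weightForm hP y z = 0) {δ : ℝ} (hδ : 0 < δ) (hδ2 : δ ≤ 1 / 4) :
    ∃ c : ℂ, ∀ᵐ x ∂unitMeasure, x ∈ Set.Ioc δ (1 - δ) → (P x : ℂ) = c := by
  set g : ℝ → ℂ := fun x => if x ≤ δ then 1 else if x ≤ 1 - δ then 0 else -1 with hg
  have hgm : Measurable g := by
    refine Measurable.ite measurableSet_Iic measurable_const ?_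
    exact Measurable.ite measurableSet_Iic measurable_const measurable_const
  have hgL : MemLp g 2 unitMeasure := by
    refine MemLp.of_bound hgm.aestronglyMeasurable 1 (Eventually.of_forall fun x => ?_)
    simp only [hg]
    split_ifs <;> simp
  have hgi : ∀ s ∈ Set.Icc (0 : ℝ) 1, ∀ t ∈ Set.Icc (0 : ℝ) 1, IntervalIntegrable g volume s t :=
    fun s hs t ht => intervalIntegrable_of_integrable (integrable_unit hgL) hs ht
  have hI1 : ∫ t in (0 : ℝ)..δ, g t = δ := by
    rw [intervalIntegral.integral_congr (g := fun _ => (1 : ℂ))]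
    · simp
    · intro x hx
      rw [Set.uIcc_of_le hδ.le] at hx
      simp [hg, hx.2]
  have hI2 : ∫ t in δ..(1 - δ), g t = 0 := by
    rw [intervalIntegral.integral_congr_ae (g := fun _ => (0 : ℂ))]
    · simp
    · refine Eventually.of_forall fun x hx => ?_
      rw [Set.uIoc_of_le (by linarith)] at hx
      simp [hg, hx.2, not_le.2 hx.1]
  have hI3 : ∫ t in (1 - δ)..1, g t = -δ := by
    rw [intervalIntegral.integral_congr_ae (g := fun _ => (-1 : ℂ))]
    · simp
    · refine Eventually.of_forall fun x hx => ?_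
      rw [Set.uIoc_of_le (by linarith)] at hx
      simp [hg, not_le.2 hx.1, not_le.2 (show δ < x by linarith [hx.1])]
  have h0 : ∫ t, g t ∂unitMeasure = 0 := by
    have m0 : (0 : ℝ) ∈ Set.Icc (0 : ℝ) 1 := by simp
    have m1 : (1 : ℝ) ∈ Set.Icc (0 : ℝ) 1 := by simp
    have md : δ ∈ Set.Icc (0 : ℝ) 1 := ⟨hδ.le, by linarith⟩
    have md' : 1 - δ ∈ Set.Icc (0 : ℝ) 1 := ⟨by linarith, by linarith⟩
    rw [← intervalIntegral_eq_unitMeasure,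
      ← intervalIntegral.integral_add_adjacent_intervals (hgi 0 m0 (1 - δ) md') (hgi _ md' 1 m1),
      ← intervalIntegral.integral_add_adjacent_intervals (hgi 0 m0 δ md) (hgi _ md _ md'),
      hI1, hI2, hI3]
    ring
  obtain ⟨y, hy⟩ := exists_primitive hgL h0
  -- primitives of functions vanishing on `[δ, 1 - δ]` are constant there
  have hconst : ∀ f : ℝ → ℂ, Integrable f unitMeasure →
      (∀ᵐ x ∂unitMeasure, x ∈ Set.Ioc δ (1 - δ) → f x = 0) → ∀ x ∈ Set.Ioc δ (1 - δ),
      ∫ t in (0 : ℝ)..x, f t = ∫ t in (0 : ℝ)..δ, f t := by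
    intro f hf hf0 x hx
    have mx : x ∈ Set.Icc (0 : ℝ) 1 := ⟨by linarith [hx.1], by linarith [hx.2]⟩
    have md : δ ∈ Set.Icc (0 : ℝ) 1 := ⟨hδ.le, by linarith⟩
    rw [← intervalIntegral.integral_add_adjacent_intervals
      (intervalIntegrable_of_integrable hf (by simp) md)
      (intervalIntegrable_of_integrable hf md mx), add_eq_left,
      intervalIntegral.integral_congr_ae (g := fun _ => (0 : ℂ))]
    · simp
    · filter_upwards [(ae_restrict_iff' measurableSet_Icc).1 hf0] with t ht htx
      rw [Set.uIoc_of_le hx.1.le] at htx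
      exact ht ⟨by linarith [htx.1], by linarith [htx.2, hx.2]⟩ ⟨htx.1, htx.2.trans hx.2⟩
  have hy0 : ∀ᵐ x ∂unitMeasure, x ∈ Set.Ioc δ (1 - δ) → deriv (y : ℝ → ℂ) x = 0 := by
    filter_upwards [hy] with x hx hxm
    rw [hx]
    simp [hg, hxm.2, not_le.2 hxm.1]
  have hyδ : ∀ x ∈ Set.Ioc δ (1 - δ), (y : ℝ → ℂ) x = δ := by
    intro x hx
    rw [apply_eq_integral_deriv y ⟨by linarith [hx.1], by linarith [hx.2]⟩,
      hconst _ (integrable_unit (memLp_deriv y)) hy0 x hx, ← hI1]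
    refine intervalIntegral.integral_congr_ae ?_
    filter_upwards [(ae_restrict_iff' measurableSet_Icc).1 hy] with t ht htx
    rw [Set.uIoc_of_le hδ.le] at htx
    exact ht ⟨htx.1.le, by linarith [htx.2]⟩
  have hv := eq_smul_oneL2 (v := mulMap hP y - primMap hP y)
    fun z => by rw [← weightForm_eq_inner]; exact h y z
  set c := (inner ℂ oneL2 (mulMap hP y - primMap hP y) : ℂ) with hc
  refine ⟨(c + ∫ t in (0 : ℝ)..δ, (P t : ℂ) * deriv (y : ℝ → ℂ) t) / δ, ?_⟩
  have e1 := Lp.coeFn_sub (mulMap hP y) (primMap hP y)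
  rw [hv] at e1
  filter_upwards [e1, Lp.coeFn_smul c oneL2, coeFn_oneL2, coeFn_mulMap hP y,
    coeFn_primMap hP y] with x e1 e2 e3 e4 e5 hx
  rw [e2, Pi.smul_apply, e3, Pi.sub_apply, e4, e5, hyδ x hx, hconst _ (integrable_mul_deriv hP y)
    (by filter_upwards [hy0] with t ht htm; rw [ht htm, mul_zero]) x hx, smul_eq_mul,
    mul_one] at e1
  have hδ' : (δ : ℂ) ≠ 0 := by exact_mod_cast hδ.ne'
  rw [eq_div_iff hδ', e1]
  ring

/-- If the form with weight `P'` vanishes, then `P` is constant. -/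
lemma exists_ae_eq_const_of_weightForm (h : ∀ y z, weightForm hP y z = 0) :
    ∃ c : ℂ, ∀ᵐ x ∂unitMeasure, (P x : ℂ) = c := by
  have hpos : ∀ i : ℕ, (0 : ℝ) < 1 / (i + 4) := fun i => by positivity
  have hle : ∀ i : ℕ, (1 : ℝ) / (i + 4) ≤ 1 / 4 := fun i =>
    one_div_le_one_div_of_le (by norm_num) (by linarith [Nat.cast_nonneg (α := ℝ) i])
  choose c hc using fun i : ℕ => exists_ae_eq_const hP h (hpos i) (hle i)
  -- the constants agree because all intervals contain `(1/4, 3/4]`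
  have hcc : ∀ i, c i = c 0 := by
    intro i
    have hm : volume (Set.Ioc (1 / 4 : ℝ) (3 / 4)) ≠ 0 := by
      rw [Real.volume_Ioc]
      norm_num
    have h1 : ∀ᵐ x ∂unitMeasure, x ∈ Set.Ioc (1 / 4 : ℝ) (3 / 4) → c i = c 0 := by
      filter_upwards [hc i, hc 0] with x h1 h2 hx
      have := hle i
      have := hle 0
      rw [← h1 ⟨by linarith [hx.1], by linarith [hx.2]⟩,
        ← h2 ⟨by linarith [hx.1], by linarith [hx.2]⟩]
    have h2 := (ae_restrict_iff' measurableSet_Icc).1 h1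
    obtain ⟨x, hx1, hx2⟩ := (frequently_ae_mem_iff.2 hm).and_eventually h2 |>.exists
    exact hx2 ⟨by linarith [hx1.1], by linarith [hx1.2]⟩ hx1
  refine ⟨c 0, ?_⟩
  filter_upwards [ae_all_iff.2 hc, ae_unitMeasure_mem_Ioo] with x hx hx01
  have hlim : Tendsto (fun i : ℕ => (1 : ℝ) / (i + 4)) atTop (𝓝 0) := by
    have := tendsto_one_div_add_atTop_nhds_zero_nat (𝕜 := ℝ)
    refine ((tendsto_add_atTop_iff_nat 3).2 this).congr fun i => ?_
    push_cast
    ring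
  obtain ⟨i, hi1, hi2⟩ := ((hlim.eventually (gt_mem_nhds hx01.1)).and
    (hlim.eventually (gt_mem_nhds (show (0 : ℝ) < 1 - x by linarith [hx01.2])))).exists
  rw [hx i ⟨hi1, by linarith⟩, hcc]

/-- If `P'` is not zero, then its quadratic form takes a nonzero value. -/
lemma exists_weightForm_ne_zero (hρ : ∃ y : sobolevZero, genDeriv P y ≠ 0) :
    ∃ y, (weightForm hP y y).re ≠ 0 := by
  by_contra! h
  obtain ⟨c, hc⟩ := exists_ae_eq_const_of_weightForm hP
    ((isHermForm_weightForm hP).eq_zero_of_re_self h)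
  obtain ⟨y, hy⟩ := hρ
  refine hy ?_
  rw [genDeriv, intervalIntegral_eq_unitMeasure,
    integral_congr_ae (g := fun x => c * star (deriv (y : ℝ → ℂ) x))
      (by filter_upwards [hc] with x hx; rw [hx]), integral_const_mul,
    integral_star_deriv_eq_zero, mul_zero, neg_zero]

include hP in
/-- If `P'` is not zero, then the index is positive for all large parameters of one sign. -/
lemma one_le_negIndex_of_large (hρ : ∃ y : sobolevZero, genDeriv P y ≠ 0) :
    (∃ c, ∀ l, c ≤ l → 1 ≤ negIndex P l) ∨ ∃ c, ∀ l, l ≤ c → 1 ≤ negIndex P l := by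
  obtain ⟨y, hy⟩ := exists_weightForm_ne_zero hP hρ
  have key : ∀ l : ℝ, (energyForm y y).re + l * (weightForm hP y y).re < 0 →
      1 ≤ negIndex P l := by
    intro l hl
    rw [negIndex_eq hP]
    have h1 := finrank_le_negInd (energyForm + (l : ℂ) • weightForm hP)
      (LinearMap.toSpanSingleton ℂ sobolevZero y) (fun c hc => by
        rw [LinearMap.toSpanSingleton_apply, LinearMap.map_smulₛₗ, LinearMap.map_smulₛₗ,
          LinearMap.smul_apply, RingHom.id_apply, smul_eq_mul, smul_eq_mul, ← mul_assoc,
          Complex.conj_mul']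
        have h2 : 0 < ‖c‖ ^ 2 := by
          have := norm_pos_iff.2 hc
          positivity
        have h3 : (((‖c‖ : ℝ) : ℂ) ^ 2 * (energyForm + (l : ℂ) • weightForm hP) y y).re =
            ‖c‖ ^ 2 * ((energyForm + (l : ℂ) • weightForm hP) y y).re := by
          rw [← Complex.ofReal_pow, Complex.re_ofReal_mul]
        rw [h3, re_add_smul_apply]
        exact mul_neg_of_pos_of_neg h2 hl)
    simpa using h1
  set S := (energyForm y y).re
  set r := (weightForm hP y y).re
  rcases lt_or_gt_of_ne hy with hr | hr
  · refine Or.inl ⟨(S + 1) / (-r), fun l hl => key l ?_⟩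
    rw [div_le_iff₀ (by linarith)] at hl
    linarith
  · refine Or.inr ⟨-((S + 1) / r), fun l hl => key l ?_⟩
    have h1 : (S + 1) / r ≤ -l := by linarith
    rw [div_le_iff₀ hr] at h1
    linarith

end NonDegenerate

end SelfSimilarSturm

theorem mainTheorem2 {n : ℕ} (a d β : Fin n → ℝ) (P : ℝ → ℝ) (ν D : ℝ)
    (hP : SelfSimilarSturm.IsSelfSimilar a d β P)
    (hν : SelfSimilarSturm.IsArithmeticWithStep a d ν)
    (hD : SelfSimilarSturm.IsSpectralOrder a d D) (hDpos : 0 < D)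
    (hρ : ∃ y : SelfSimilarSturm.sobolevZero, SelfSimilarSturm.genDeriv P y ≠ 0)
    (heven : ∀ k, 0 < d k → ∃ m : ℤ, Even m ∧ Real.log (a k * |d k|) / ν = m)
    (hodd : ∀ k, d k < 0 → ∃ m : ℤ, Odd m ∧ Real.log (a k * |d k|) / ν = m) :
    (∀ l : ℝ, SelfSimilarSturm.negIndex P l ≠ ⊤) ∧
    ∃ s : ℝ → ℝ, Continuous s ∧ (∀ t, 0 < s t) ∧ Function.Periodic s 2 ∧
      (∃ ε : ℝ → ℝ, Tendsto ε atTop (𝓝 0) ∧ ∀ l : ℝ, 0 < l →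
        ((SelfSimilarSturm.negIndex P l).toNat : ℝ) =
          l ^ (D / 2) * (s (Real.log l / ν) + ε l)) ∧
      (∃ ε : ℝ → ℝ, Tendsto ε atBot (𝓝 0) ∧ ∀ l : ℝ, l < 0 →
        ((SelfSimilarSturm.negIndex P l).toNat : ℝ) =
          |l| ^ (D / 2) * (s (Real.log |l| / ν - 1) + ε l)) := by
  have hfin := hP.negIndex_ne_top
  have hcoe : ∀ l, SelfSimilarSturm.negIndex P l =
      ((SelfSimilarSturm.negIndex P l).toNat : ℕ∞) := fun l => (ENat.natCast_toNat (hfin l)).symm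
  refine ⟨hfin, SelfSimilarSturm.counting_asymptotics
    (N := fun l => (SelfSimilarSturm.negIndex P l).toNat) hP.pos hP.mul_abs_lt_one hν hD hDpos
    heven hodd ?_ (fun l => ?_) (fun l₀ => ?_) ?_⟩
  · obtain ⟨δ, hδ, h⟩ := hP.exists_small
    exact ⟨δ, hδ, fun l hl => by simp [h l hl]⟩
  · have h1 := hP.le_negIndex fun k => hcoe (a k * d k * l)
    have h2 := hP.negIndex_le fun k => hcoe (a k * d k * l)
    rw [hcoe l, Nat.cast_le] at h1 h2
    exact ⟨h1, h2⟩
  · filter_upwards [SelfSimilarSturm.eventually_negIndex hP.memLp (hcoe l₀)] with l hl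
    rw [hcoe l, Nat.cast_le, Nat.cast_le] at hl
    exact hl
  · refine (SelfSimilarSturm.one_le_negIndex_of_large hP.memLp hρ).imp ?_ ?_ <;>
    · rintro ⟨c, hc⟩
      refine ⟨c, fun l hl => ?_⟩
      have := hc l hl
      rw [hcoe l] at this
      exact_mod_cast this
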